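/- Let $q\in\mathbb R\setminus\{0\}$. Let $\mathbb C_q[SU_2]$ be the unital $*$-algebra generated by $a,b,c,d$ with $ab=qba$, $ac=qca$, $bd=qdb$, $cd=qdc$, $bc=cb$, $ad-da=(q-q^{-1})bc$, $ad-qbc=1$, and $a^*=d$, $b^*=-qc$, $c^*=-q^{-1}b$, $d^*=a$, with the matrix coproduct $\Delta$ and Haar functional $h$. Let $\pi:\mathbb C_q[SU_2]\to\mathbb C[t,t^{-1}]$, $\pi(a)=t^{-1}$, $\pi(d)=t$, $\pi(b)=\pi(c)=0$, put $\mathcal E_k=\{f:(\mathrm{id}\otimes\pi)\Delta(f)=f\otimes t^k\}$, and let $\mathbb C_q[S^2]=\mathcal E_0$ be the standard Podleś sphere. (Thus $\deg a=\deg c=-1$, $\deg b=\deg d=1$.) Let $D_\pm$ be the linear maps on $\mathbb C_q[SU_2]$ that satisfy $D_\pm(fg)=f\,D_\pm(g)+q^{k}D_\pm(f)\,g$ for $g\in\mathcal E_k$, with $D_+(a)=q^{-1}b$, $D_+(c)=q^{-1}d$, $D_+(b)=D_+(d)=0$ and $D_-(b)=-iq\,a$, $D_-(d)=-iq\,c$,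 $D_-(a)=D_-(c)=0$. The covariant differential $*$-calculus of the sphere is $$\Omega^\bullet=\mathcal E_0\oplus\mathcal E_2e^+\oplus\mathcal E_{-2}e^-\oplus\mathcal E_0\tau ,$$ with $fe^+\wedge ge^-=fg\,\tau$, $ge^-\wedge fe^+=-q^2gf\,\tau$, $e^\pm\wedge e^\pm=0$, $\mathrm d=\partial+\bar\partial$ and $$\partial m=D_+(m)e^+,\quad \partial(ge^-)=q^2D_+(g)\tau,\qquad \bar\partial m=D_-(m)e^-,\quad \bar\partial(fe^+)=-D_-(f)\tau,$$ where $\partial$ is zero on $\mathcal E_2e^+\oplus\mathcal E_0\tau$ and $\bar\partial$ is zero on $\mathcal E_{-2}e^-\oplus\mathcal E_0\tau$. The involution on forms is $(fe^+)^*=if^*e^-$, $(ge^-)^*=ig^*e^+$, $(t\tau)^*=t^*\tau$. Let $g$ be the sesquilinear metric for which the four summands are orthogonal and $g(m,n)=mn^*$, $g(fe^+,f'e^+)=ff'^*$, $g(ke^-,k'e^-)=q^2kk'^*$, $g(s\tau,t\tau)=st^*$; let $*_H$ be its Hodge map, determined by $g(\omega,\nu)\tau=\omega\wedge *_H(\nu^*)$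 for all $\omega,\nu$ of the same degree, that is, $*_H(m)=m\tau$, $*_H(t\tau)=t$, $*_H(fe^+)=ife^+$, $*_H(ke^-)=-ike^-$. Let $\int t\tau=h(t)$, let $\int$ vanish on forms of degree less than $2$, and let $\langle\omega,\nu\rangle=\int g(\omega,\nu)\tau$. Then, with respect to $\langle\cdot,\cdot\rangle$, each of the operators $\mathrm d,\partial,\bar\partial$ on $\Omega^\bullet$ has exactly one linear adjoint (a linear map $S$ with $\langle T\omega,\nu\rangle=\langle\omega,S\nu\rangle$ for all $\omega,\nu\in\Omega^\bullet$), and $$\mathrm d^*=-*_H\,\mathrm d\,*_H,\qquad \partial^*=-*_H\,\bar\partial\,*_H,\qquad \bar\partial^*=-*_H\,\partial\,*_H .$$ -/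

import Mathlib

noncomputable section

namespace Podles

open scoped TensorProduct ComplexConjugate

set_option linter.unusedSimpArgs false

/-- The deformation parameter, as a complex scalar. -/
def qc (q : ℝˣ) : ℂ := ((q : ℝ) : ℂ)

theorem qc_ne (q : ℝˣ) : qc q ≠ 0 := by
  simp [qc]

theorem conj_qc (q : ℝˣ) : conj (qc q) = qc q := Complex.conj_ofReal _

/-! ### The coordinate algebra of quantum `SU(2)` -/

/-- The four matrix coefficients generating the coordinate algebra. -/
inductive Gen
  | a | b | c | d

open FreeAlgebra in
/-- The defining relations of quantum `SL(2)`. -/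
inductive Rel (q : ℝˣ) : FreeAlgebra ℂ Gen → FreeAlgebra ℂ Gen → Prop
  | ab : Rel q (ι ℂ Gen.a * ι ℂ Gen.b) (qc q • (ι ℂ Gen.b * ι ℂ Gen.a))
  | ac : Rel q (ι ℂ Gen.a * ι ℂ Gen.c) (qc q • (ι ℂ Gen.c * ι ℂ Gen.a))
  | bd : Rel q (ι ℂ Gen.b * ι ℂ Gen.d) (qc q • (ι ℂ Gen.d * ι ℂ Gen.b))
  | cd : Rel q (ι ℂ Gen.c * ι ℂ Gen.d) (qc q • (ι ℂ Gen.d * ι ℂ Gen.c))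
  | bc : Rel q (ι ℂ Gen.b * ι ℂ Gen.c) (ι ℂ Gen.c * ι ℂ Gen.b)
  | comm : Rel q (ι ℂ Gen.a * ι ℂ Gen.d - ι ℂ Gen.d * ι ℂ Gen.a)
      ((qc q - (qc q)⁻¹) • (ι ℂ Gen.b * ι ℂ Gen.c))
  | det : Rel q (ι ℂ Gen.a * ι ℂ Gen.d - qc q • (ι ℂ Gen.b * ι ℂ Gen.c)) 1

/-- The unital complex algebra with generators `a, b, c, d` and the above relations. -/
def SUq (q : ℝˣ) : Type := RingQuot (Rel q)

instance (q : ℝˣ) : Ring (SUq q) := inferInstanceAs (Ring (RingQuot (Rel q)))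
instance (q : ℝˣ) : Algebra ℂ (SUq q) := inferInstanceAs (Algebra ℂ (RingQuot (Rel q)))

/-- The quotient map from the free algebra. -/
def mk (q : ℝˣ) : FreeAlgebra ℂ Gen →ₐ[ℂ] SUq q := RingQuot.mkAlgHom ℂ (Rel q)

/-- The generators, in the quotient. -/
def gen (q : ℝˣ) (x : Gen) : SUq q := mk q (FreeAlgebra.ι ℂ x)

variable {q : ℝˣ}

/-- Four elements of an algebra that satisfy the relations of quantum `SL(2)`. -/
structure IsTuple (q : ℝˣ) {B : Type*} [Ring B] [Algebra ℂ B] (a b c d : B) : Prop where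
  ab : a * b = qc q • (b * a)
  ac : a * c = qc q • (c * a)
  bd : b * d = qc q • (d * b)
  cd : c * d = qc q • (d * c)
  bc : b * c = c * b
  comm : a * d - d * a = (qc q - (qc q)⁻¹) • (b * c)
  det : a * d - qc q • (b * c) = 1

theorem mk_rel {x y : FreeAlgebra ℂ Gen} (h : Rel q x y) : mk q x = mk q y :=
  RingQuot.mkAlgHom_rel ℂ h

theorem gen_isTuple (q : ℝˣ) :
    IsTuple q (gen q Gen.a) (gen q Gen.b) (gen q Gen.c) (gen q Gen.d) where
  ab := by simpa [gen] using mk_rel (Rel.ab (q := q))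
  ac := by simpa [gen] using mk_rel (Rel.ac (q := q))
  bd := by simpa [gen] using mk_rel (Rel.bd (q := q))
  cd := by simpa [gen] using mk_rel (Rel.cd (q := q))
  bc := by simpa [gen] using mk_rel (Rel.bc (q := q))
  comm := by simpa [gen] using mk_rel (Rel.comm (q := q))
  det := by simpa [gen] using mk_rel (Rel.det (q := q))

/-- The assignment of the generators to four given elements. -/
def pick {B : Type*} (a b c d : B) : Gen → B
  | Gen.a => a
  | Gen.b => b
  | Gen.c => c
  | Gen.d => d

/-- The universal property of the algebra. -/
def lift {B : Type*} [Ring B] [Algebra ℂ B] {a b c d : B} (h : IsTuple q a b c d) :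
    SUq q →ₐ[ℂ] B :=
  RingQuot.liftAlgHom ℂ ⟨FreeAlgebra.lift ℂ (pick a b c d), by
    intro x y hxy
    cases hxy
    · simpa [pick] using h.ab
    · simpa [pick] using h.ac
    · simpa [pick] using h.bd
    · simpa [pick] using h.cd
    · simpa [pick] using h.bc
    · simpa [pick] using h.comm
    · simpa [pick] using h.det⟩

@[simp] theorem lift_gen {B : Type*} [Ring B] [Algebra ℂ B] {a b c d : B}
    (h : IsTuple q a b c d) (x : Gen) : lift h (gen q x) = pick a b c d x := by
  unfold lift gen mk
  erw [RingQuot.liftAlgHom_mkAlgHom_apply]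
  simp

theorem SUq.induction {P : SUq q → Prop} (hs : ∀ r : ℂ, P (algebraMap ℂ (SUq q) r))
    (hg : ∀ x, P (gen q x)) (hm : ∀ x y, P x → P y → P (x * y))
    (ha : ∀ x y, P x → P y → P (x + y)) (x : SUq q) : P x := by
  obtain ⟨w, rfl⟩ : ∃ w, mk q w = x := RingQuot.mkAlgHom_surjective ℂ (Rel q) x
  induction w using FreeAlgebra.induction with
  | grade0 r => simpa using hs r
  | grade1 x => exact hg x
  | mul x y hx hy => simpa using hm _ _ hx hy
  | add x y hx hy => simpa using ha _ _ hx hy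

theorem ba : gen q Gen.b * gen q Gen.a = (qc q)⁻¹ • (gen q Gen.a * gen q Gen.b) := by
  rw [(gen_isTuple q).ab, inv_smul_smul₀ (qc_ne q)]

theorem ca : gen q Gen.c * gen q Gen.a = (qc q)⁻¹ • (gen q Gen.a * gen q Gen.c) := by
  rw [(gen_isTuple q).ac, inv_smul_smul₀ (qc_ne q)]

theorem db : gen q Gen.d * gen q Gen.b = (qc q)⁻¹ • (gen q Gen.b * gen q Gen.d) := by
  rw [(gen_isTuple q).bd, inv_smul_smul₀ (qc_ne q)]

theorem dc : gen q Gen.d * gen q Gen.c = (qc q)⁻¹ • (gen q Gen.c * gen q Gen.d) := by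
  rw [(gen_isTuple q).cd, inv_smul_smul₀ (qc_ne q)]

theorem cb : gen q Gen.c * gen q Gen.b = gen q Gen.b * gen q Gen.c := (gen_isTuple q).bc.symm

theorem ad : gen q Gen.a * gen q Gen.d = 1 + qc q • (gen q Gen.b * gen q Gen.c) := by
  rw [← (gen_isTuple q).det]; abel

theorem da : gen q Gen.d * gen q Gen.a = 1 + (qc q)⁻¹ • (gen q Gen.b * gen q Gen.c) := by
  have h := (gen_isTuple q).comm
  rw [ad, sub_smul] at h
  rw [← sub_eq_zero] at h ⊢
  rw [← neg_eq_zero, ← h]; abel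

/-! ### The `*`-structure -/

/-- The opposite of a complex algebra, with complex conjugate scalar multiplication. -/
def ConjOp (A : Type*) : Type _ := Aᵐᵒᵖ

instance (A : Type*) [Ring A] : Ring (ConjOp A) := inferInstanceAs (Ring Aᵐᵒᵖ)

instance (A : Type*) [Ring A] [Algebra ℂ A] : Algebra ℂ (ConjOp A) where
  smul r x := MulOpposite.op (conj r • MulOpposite.unop x)
  algebraMap := (algebraMap ℂ Aᵐᵒᵖ).comp (starRingEnd ℂ)
  commutes' r x := Algebra.commutes (A := Aᵐᵒᵖ) (conj r) x
  smul_def' r x := Algebra.smul_def (A := Aᵐᵒᵖ) (conj r) x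

/-- The identity map to the conjugate opposite algebra. -/
def cop {A : Type*} (x : A) : ConjOp A := MulOpposite.op x

/-- The identity map from the conjugate opposite algebra. -/
def uncop {A : Type*} (x : ConjOp A) : A := MulOpposite.unop x

section
variable {A : Type*} [Ring A] [Algebra ℂ A]
set_option linter.unusedSectionVars false
@[simp] theorem uncop_cop (x : A) : uncop (cop x) = x := rfl
@[simp] theorem uncop_add (x y : ConjOp A) : uncop (x + y) = uncop x + uncop y := rfl
@[simp] theorem uncop_sub (x y : ConjOp A) : uncop (x - y) = uncop x - uncop y := rfl
@[simp] theorem uncop_mul (x y : ConjOp A) : uncop (x * y) = uncop y * uncop x := rfl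
@[simp] theorem uncop_one : uncop (1 : ConjOp A) = 1 := rfl
@[simp] theorem uncop_smul (r : ℂ) (x : ConjOp A) : uncop (r • x) = conj r • uncop x := rfl
@[simp] theorem uncop_algebraMap (r : ℂ) :
    uncop (algebraMap ℂ (ConjOp A) r) = algebraMap ℂ A (conj r) := rfl
theorem uncop_injective {x y : ConjOp A} (h : uncop x = uncop y) : x = y :=
  MulOpposite.unop_injective h
end

theorem star_isTuple (q : ℝˣ) :
    IsTuple q (cop (gen q Gen.d)) (cop (-qc q • gen q Gen.c))
      (cop (-(qc q)⁻¹ • gen q Gen.b)) (cop (gen q Gen.a)) := by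
  have hq := qc_ne q
  have h1 := conj_qc q
  constructor <;> apply uncop_injective <;>
    simp only [uncop_mul, uncop_smul, uncop_cop, uncop_sub, uncop_one, map_sub, map_inv₀, h1,
      smul_mul_assoc, mul_smul_comm, ba, ca, db, dc, cb, ad, da] <;>
    match_scalars <;> field_simp <;> ring

/-- The involution, as an algebra map to the conjugate opposite algebra: `a* = d`, `b* = -q c`,
`c* = -q⁻¹ b`, `d* = a`. -/
def starHom (q : ℝˣ) : SUq q →ₐ[ℂ] ConjOp (SUq q) := lift (star_isTuple q)

instance (q : ℝˣ) : Star (SUq q) := ⟨fun x => uncop (starHom q x)⟩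

theorem star_def (x : SUq q) : star x = uncop (starHom q x) := rfl

theorem star_a : star (gen q Gen.a) = gen q Gen.d := by simp [star_def, starHom, pick]
theorem star_b : star (gen q Gen.b) = -qc q • gen q Gen.c := by simp [star_def, starHom, pick]
theorem star_c : star (gen q Gen.c) = -(qc q)⁻¹ • gen q Gen.b := by
  simp [star_def, starHom, pick]
theorem star_d : star (gen q Gen.d) = gen q Gen.a := by simp [star_def, starHom, pick]

theorem star_smul_aux (r : ℂ) (x : SUq q) : star (r • x) = conj r • star x := by
  simp [star_def]

theorem star_algebraMap_aux (r : ℂ) :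
    star (algebraMap ℂ (SUq q) r) = algebraMap ℂ (SUq q) (conj r) := by
  simp [star_def]

theorem star_star_aux (x : SUq q) : star (star x) = x := by
  induction x using SUq.induction with
  | hs r => simp [star_algebraMap_aux]
  | hg x =>
    cases x
    · simp [star_a, star_d]
    · rw [star_b, star_smul_aux, star_c, smul_smul]; simp [conj_qc, qc_ne]
    · rw [star_c, star_smul_aux, star_b, smul_smul]; simp [conj_qc, qc_ne]
    · simp [star_a, star_d]
  | hm x y hx hy =>
    simp only [star_def, map_mul, uncop_mul] at hx hy ⊢
    rw [hx, hy]
  | ha x y hx hy =>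
    simp only [star_def, map_add, uncop_add] at hx hy ⊢
    rw [hx, hy]

instance (q : ℝˣ) : StarRing (SUq q) where
  star_involutive := star_star_aux
  star_mul x y := by simp [star_def]
  star_add x y := by simp [star_def]

instance (q : ℝˣ) : StarModule ℂ (SUq q) := ⟨fun r x => star_smul_aux r x⟩

/-! ### Coproduct, the circle subgroup and the grading -/

theorem coprod_isTuple (q : ℝˣ) :
    IsTuple q
      (gen q Gen.a ⊗ₜ[ℂ] gen q Gen.a + gen q Gen.b ⊗ₜ[ℂ] gen q Gen.c)
      (gen q Gen.a ⊗ₜ[ℂ] gen q Gen.b + gen q Gen.b ⊗ₜ[ℂ] gen q Gen.d)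
      (gen q Gen.c ⊗ₜ[ℂ] gen q Gen.a + gen q Gen.d ⊗ₜ[ℂ] gen q Gen.c)
      (gen q Gen.c ⊗ₜ[ℂ] gen q Gen.b + gen q Gen.d ⊗ₜ[ℂ] gen q Gen.d) := by
  have hq := qc_ne q
  constructor <;>
    simp only [mul_add, add_mul, Algebra.TensorProduct.tmul_mul_tmul, ba, ca, db, dc, cb, ad, da,
      TensorProduct.tmul_add, TensorProduct.add_tmul, TensorProduct.tmul_smul,
      ← TensorProduct.smul_tmul', Algebra.TensorProduct.one_def] <;>
    match_scalars <;> field_simp <;> ring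

/-- The coproduct. -/
def coprod (q : ℝˣ) : SUq q →ₐ[ℂ] SUq q ⊗[ℂ] SUq q := lift (coprod_isTuple q)

open LaurentPolynomial in
theorem proj_isTuple (q : ℝˣ) :
    IsTuple q (T (-1) : LaurentPolynomial ℂ) 0 0 (T 1) := by
  constructor <;> simp only [← T_add, mul_zero, zero_mul, smul_zero, sub_zero] <;>
    simp

/-- The projection onto the coordinate algebra of the circle:
`a ↦ t⁻¹`, `d ↦ t`, `b, c ↦ 0`. -/
def proj (q : ℝˣ) : SUq q →ₐ[ℂ] LaurentPolynomial ℂ := lift (proj_isTuple q)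

/-- The right coaction `(id ⊗ π) ∘ Δ` of the circle. -/
def coact (q : ℝˣ) : SUq q →ₐ[ℂ] SUq q ⊗[ℂ] LaurentPolynomial ℂ :=
  (Algebra.TensorProduct.map (AlgHom.id ℂ (SUq q)) (proj q)).comp (coprod q)

/-- The part of degree `k`: all `f` with `(id ⊗ π)(Δ f) = f ⊗ tᵏ`. The quantum sphere is the part
of degree `0`. -/
def E (q : ℝˣ) (k : ℤ) : Submodule ℂ (SUq q) :=
  LinearMap.eqLocus (coact q).toLinearMap
    ((TensorProduct.mk ℂ (SUq q) (LaurentPolynomial ℂ)).flip (LaurentPolynomial.T k))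

theorem mem_E {k : ℤ} {f : SUq q} : f ∈ E q k ↔ coact q f = f ⊗ₜ LaurentPolynomial.T k := Iff.rfl

/-- The degrees of the generators. -/
def deg : Gen → ℤ := pick (-1) 1 (-1) 1

theorem gen_mem_E (q : ℝˣ) (x : Gen) : gen q x ∈ E q (deg x) := by
  rw [mem_E]
  cases x <;> simp [coact, coprod, proj, pick, deg]

theorem mul_mem_E {k l m : ℤ} {f g : SUq q} (hf : f ∈ E q k) (hg : g ∈ E q l) (h : m = k + l) :
    f * g ∈ E q m := by
  rw [mem_E] at *
  rw [map_mul, hf, hg, Algebra.TensorProduct.tmul_mul_tmul, h, LaurentPolynomial.T_add]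

theorem algebraMap_mem_E (q : ℝˣ) (r : ℂ) : algebraMap ℂ (SUq q) r ∈ E q 0 := by
  rw [mem_E, AlgHom.commutes, LaurentPolynomial.T_zero]
  rfl

/-! ### The two twisted derivations -/

theorem twist_isTuple (q : ℝˣ) :
    IsTuple q ((qc q)⁻¹ • gen q Gen.a) (qc q • gen q Gen.b)
      ((qc q)⁻¹ • gen q Gen.c) (qc q • gen q Gen.d) := by
  have hq := qc_ne q
  constructor <;>
    simp only [smul_mul_assoc, mul_smul_comm, ba, ca, db, dc, cb, ad, da] <;>
    match_scalars <;> field_simp <;> ring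

/-- The automorphism multiplying elements of degree `k` by `qᵏ`. -/
def twist (q : ℝˣ) : SUq q →ₐ[ℂ] SUq q := lift (twist_isTuple q)

theorem twist_gen (x : Gen) : twist q (gen q x) = qc q ^ deg x • gen q x := by
  cases x <;> simp [twist, pick, deg]

theorem plus_isTuple (q : ℝˣ) :
    IsTuple q
      !![gen q Gen.a, (qc q)⁻¹ • gen q Gen.b; 0, (qc q)⁻¹ • gen q Gen.a]
      !![gen q Gen.b, 0; 0, qc q • gen q Gen.b]
      !![gen q Gen.c, (qc q)⁻¹ • gen q Gen.d; 0, (qc q)⁻¹ • gen q Gen.c]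
      !![gen q Gen.d, 0; 0, qc q • gen q Gen.d] := by
  have hq := qc_ne q
  constructor <;> ext i j <;> fin_cases i <;> fin_cases j <;>
    simp [Matrix.mul_apply, Fin.sum_univ_two, ba, ca, db, dc, cb, ad, da] <;>
    match_scalars <;> field_simp <;> ring

theorem minus_isTuple (q : ℝˣ) :
    IsTuple q
      !![gen q Gen.a, 0; 0, (qc q)⁻¹ • gen q Gen.a]
      !![gen q Gen.b, (-Complex.I * qc q) • gen q Gen.a; 0, qc q • gen q Gen.b]
      !![gen q Gen.c, 0; 0, (qc q)⁻¹ • gen q Gen.c]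
      !![gen q Gen.d, (-Complex.I * qc q) • gen q Gen.c; 0, qc q • gen q Gen.d] := by
  have hq := qc_ne q
  constructor <;> ext i j <;> fin_cases i <;> fin_cases j <;>
    simp [Matrix.mul_apply, Fin.sum_univ_two, ba, ca, db, dc, cb, ad, da] <;>
    match_scalars <;> field_simp <;> ring

/-- The algebra map `f ↦ (f, D₊ f; 0, twist f)`. -/
def plusHom (q : ℝˣ) : SUq q →ₐ[ℂ] Matrix (Fin 2) (Fin 2) (SUq q) := lift (plus_isTuple q)

/-- The algebra map `f ↦ (f, D₋ f; 0, twist f)`. -/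
def minusHom (q : ℝˣ) : SUq q →ₐ[ℂ] Matrix (Fin 2) (Fin 2) (SUq q) := lift (minus_isTuple q)

/-- The twisted derivation `D₊`, with `D₊ a = q⁻¹ b`, `D₊ c = q⁻¹ d`, `D₊ b = D₊ d = 0`. -/
def Dplus (q : ℝˣ) : SUq q →ₗ[ℂ] SUq q :=
  (Matrix.entryLinearMap ℂ (SUq q) 0 1).comp (plusHom q).toLinearMap

/-- The twisted derivation `D₋`, with `D₋ b = -i q a`, `D₋ d = -i q c`, `D₋ a = D₋ c = 0`. -/
def Dminus (q : ℝˣ) : SUq q →ₗ[ℂ] SUq q :=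
  (Matrix.entryLinearMap ℂ (SUq q) 0 1).comp (minusHom q).toLinearMap

theorem Dplus_def (f : SUq q) : Dplus q f = plusHom q f 0 1 := rfl
theorem Dminus_def (f : SUq q) : Dminus q f = minusHom q f 0 1 := rfl

theorem plusHom_entries (f : SUq q) :
    plusHom q f 0 0 = f ∧ plusHom q f 1 0 = 0 ∧ plusHom q f 1 1 = twist q f := by
  induction f using SUq.induction with
  | hs r => simp [Matrix.algebraMap_matrix_apply]
  | hg x => cases x <;> simp [plusHom, twist, pick]
  | hm x y hx hy =>
    obtain ⟨x1, x2, x3⟩ := hx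
    obtain ⟨y1, y2, y3⟩ := hy
    simp [Matrix.mul_apply, Fin.sum_univ_two, x1, x2, x3, y1, y2, y3]
  | ha x y hx hy =>
    obtain ⟨x1, x2, x3⟩ := hx
    obtain ⟨y1, y2, y3⟩ := hy
    simp [x1, x2, x3, y1, y2, y3]

theorem minusHom_entries (f : SUq q) :
    minusHom q f 0 0 = f ∧ minusHom q f 1 0 = 0 ∧ minusHom q f 1 1 = twist q f := by
  induction f using SUq.induction with
  | hs r => simp [Matrix.algebraMap_matrix_apply]
  | hg x => cases x <;> simp [minusHom, twist, pick]
  | hm x y hx hy =>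
    obtain ⟨x1, x2, x3⟩ := hx
    obtain ⟨y1, y2, y3⟩ := hy
    simp [Matrix.mul_apply, Fin.sum_univ_two, x1, x2, x3, y1, y2, y3]
  | ha x y hx hy =>
    obtain ⟨x1, x2, x3⟩ := hx
    obtain ⟨y1, y2, y3⟩ := hy
    simp [x1, x2, x3, y1, y2, y3]

theorem Dplus_mul (f g : SUq q) : Dplus q (f * g) = f * Dplus q g + Dplus q f * twist q g := by
  simp [Dplus_def, Matrix.mul_apply, Fin.sum_univ_two, plusHom_entries]

theorem Dminus_mul (f g : SUq q) :
    Dminus q (f * g) = f * Dminus q g + Dminus q f * twist q g := by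
  simp [Dminus_def, Matrix.mul_apply, Fin.sum_univ_two, minusHom_entries]

theorem Dplus_algebraMap (r : ℂ) : Dplus q (algebraMap ℂ (SUq q) r) = 0 := by
  simp [Dplus_def, Matrix.algebraMap_matrix_apply]

theorem Dminus_algebraMap (r : ℂ) : Dminus q (algebraMap ℂ (SUq q) r) = 0 := by
  simp [Dminus_def, Matrix.algebraMap_matrix_apply]

theorem Dplus_a : Dplus q (gen q Gen.a) = (qc q)⁻¹ • gen q Gen.b := by
  simp [Dplus_def, plusHom, pick]
theorem Dplus_b : Dplus q (gen q Gen.b) = 0 := by simp [Dplus_def, plusHom, pick]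
theorem Dplus_c : Dplus q (gen q Gen.c) = (qc q)⁻¹ • gen q Gen.d := by
  simp [Dplus_def, plusHom, pick]
theorem Dplus_d : Dplus q (gen q Gen.d) = 0 := by simp [Dplus_def, plusHom, pick]
theorem Dminus_a : Dminus q (gen q Gen.a) = 0 := by simp [Dminus_def, minusHom, pick]
theorem Dminus_b : Dminus q (gen q Gen.b) = (-Complex.I * qc q) • gen q Gen.a := by
  simp [Dminus_def, minusHom, pick]
theorem Dminus_c : Dminus q (gen q Gen.c) = 0 := by simp [Dminus_def, minusHom, pick]
theorem Dminus_d : Dminus q (gen q Gen.d) = (-Complex.I * qc q) • gen q Gen.c := by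
  simp [Dminus_def, minusHom, pick]

/-! ### Compatibility with the grading -/

/-- The matrix whose powers hold the structure constants of the commutation relation of `D₊` and
`D₋` on elements of degree `k`. -/
def weight (q : ℝˣ) : Matrix (Fin 2) (Fin 2) ℂ := !![1, Complex.I * qc q ^ 2; 0, qc q ^ 2]

theorem weight_isUnit (q : ℝˣ) : IsUnit (weight q).det := by
  simp [weight, Matrix.det_fin_two, qc_ne q]

theorem weight_zpow (q : ℝˣ) (k : ℤ) :
    (weight q ^ k) 0 0 = 1 ∧ (weight q ^ k) 1 0 = 0 ∧ (weight q ^ k) 1 1 = (qc q ^ k) ^ 2 := by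
  have hq := qc_ne q
  have hinv : (weight q)⁻¹ = !![1, -Complex.I; 0, (qc q ^ 2)⁻¹] := by
    apply Matrix.inv_eq_right_inv
    ext i j
    fin_cases i <;> fin_cases j <;> simp [weight, Matrix.mul_apply, Fin.sum_univ_two, hq]
  induction k with
  | zero => simp
  | succ n ih =>
    rw [Matrix.zpow_add_one (weight_isUnit q), zpow_add_one₀ hq]
    simp only [Matrix.mul_apply, Fin.sum_univ_two, ih.1, ih.2.1, ih.2.2]
    simp [weight]
    ring
  | pred n ih =>
    rw [Matrix.zpow_sub_one (weight_isUnit q), hinv, zpow_sub_one₀ hq]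
    simp only [Matrix.mul_apply, Fin.sum_univ_two, ih.1, ih.2.1, ih.2.2]
    simp
    ring

theorem weight_zpow_add (q : ℝˣ) (k l : ℤ) :
    (weight q ^ (k + l)) 0 1 = (weight q ^ l) 0 1 + (weight q ^ k) 0 1 * (qc q ^ l) ^ 2 := by
  rw [Matrix.zpow_add (weight_isUnit q)]
  simp [Matrix.mul_apply, Fin.sum_univ_two, weight_zpow]

theorem conj_qc_zpow (q : ℝˣ) (k : ℤ) : star (qc q ^ k) = qc q ^ k := by
  rw [star_zpow₀]
  exact congrArg (· ^ k) (conj_qc q)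

/-- Homogeneous elements of degree `k` on which all structure maps behave as expected. -/
def good (q : ℝˣ) (k : ℤ) : Submodule ℂ (SUq q) where
  carrier := {f | f ∈ E q k ∧ star f ∈ E q (-k) ∧ twist q f = qc q ^ k • f ∧
    Dplus q f ∈ E q (k + 2) ∧ Dminus q f ∈ E q (k - 2) ∧
    Dplus q (star f) = (Complex.I * (qc q ^ k)⁻¹) • star (Dminus q f) ∧
    Dminus q (Dplus q f) - qc q ^ 2 • Dplus q (Dminus q f) = (weight q ^ k) 0 1 • f}
  zero_mem' := by simp
  add_mem' := by
    rintro x y ⟨x1, x2, x3, x4, x5, x6, x7⟩ ⟨y1, y2, y3, y4, y5, y6, y7⟩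
    simp only [Set.mem_ofPred_eq, map_add, star_add, smul_add, x3, y3, x6, y6, ← x7, ← y7]
    refine ⟨add_mem x1 y1, add_mem x2 y2, trivial, add_mem x4 y4, add_mem x5 y5, trivial, ?_⟩
    abel
  smul_mem' := by
    rintro r x ⟨x1, x2, x3, x4, x5, x6, x7⟩
    simp only [Set.mem_ofPred_eq, map_smul, star_smul, x3, x6]
    refine ⟨Submodule.smul_mem _ _ x1, Submodule.smul_mem _ _ x2, smul_comm _ _ _,
      Submodule.smul_mem _ _ x4, Submodule.smul_mem _ _ x5, smul_comm _ _ _, ?_⟩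
    rw [smul_comm _ r x, ← x7, smul_sub, smul_comm r]

theorem twist_star_aux (f : SUq q) : twist q (star (twist q f)) = star f := by
  have hq := qc_ne q
  have h1 : star (qc q) = qc q := conj_qc q
  induction f using SUq.induction with
  | hs r => simp [star_algebraMap_aux]
  | hg x =>
    cases x <;>
      simp [twist, pick, star_a, star_b, star_c, star_d, star_smul, smul_smul, h1, hq]
  | hm x y hx hy => simp [hx, hy]
  | ha x y hx hy => simp [hx, hy]

theorem twist_star {k : ℤ} {f : SUq q} (hf : f ∈ good q k) :
    twist q (star f) = (qc q ^ k)⁻¹ • star f := by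
  have h := twist_star_aux f
  rw [hf.2.2.1, star_smul, conj_qc_zpow, map_smul] at h
  conv_rhs => rw [← h, inv_smul_smul₀ (zpow_ne_zero _ (qc_ne q))]

theorem twist_twist_comm_plus (f : SUq q) :
    twist q (Dplus q f) = qc q ^ 2 • Dplus q (twist q f) := by
  have hq := qc_ne q
  induction f using SUq.induction with
  | hs r => simp [Dplus_algebraMap]
  | hg x =>
    cases x <;> simp [twist, pick, Dplus_a, Dplus_b, Dplus_c, Dplus_d] <;>
      match_scalars <;> field_simp
  | hm x y hx hy => simp [Dplus_mul, hx, hy, smul_add]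
  | ha x y hx hy => simp [hx, hy]

theorem twist_twist_comm_minus (f : SUq q) :
    twist q (Dminus q f) = (qc q ^ 2)⁻¹ • Dminus q (twist q f) := by
  have hq := qc_ne q
  induction f using SUq.induction with
  | hs r => simp [Dminus_algebraMap]
  | hg x =>
    cases x <;> simp [twist, pick, Dminus_a, Dminus_b, Dminus_c, Dminus_d] <;>
      match_scalars <;> field_simp
  | hm x y hx hy => simp [Dminus_mul, hx, hy, smul_add]
  | ha x y hx hy => simp [hx, hy]

theorem mul_mem_good {k l : ℤ} {f g : SUq q} (hf : f ∈ good q k) (hg : g ∈ good q l) :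
    f * g ∈ good q (k + l) := by
  have x2' := twist_star hf
  obtain ⟨x1, x2, x3, x4, x5, x6, x7⟩ := hf
  obtain ⟨y1, y2, y3, y4, y5, y6, y7⟩ := hg
  have hq := qc_ne q
  refine ⟨mul_mem_E x1 y1 rfl, ?_, ?_, ?_, ?_, ?_, ?_⟩
  · rw [star_mul]
    exact mul_mem_E y2 x2 (by ring)
  · rw [map_mul, x3, y3, zpow_add₀ hq]
    simp [smul_smul, mul_comm]
  · rw [Dplus_mul, y3]
    exact add_mem (mul_mem_E x1 y4 (by ring))
      (mul_mem_E x4 (Submodule.smul_mem _ _ y1) (by ring))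
  · rw [Dminus_mul, y3]
    exact add_mem (mul_mem_E x1 y5 (by ring))
      (mul_mem_E x5 (Submodule.smul_mem _ _ y1) (by ring))
  · rw [star_mul, Dplus_mul, x2', y6, x6, Dminus_mul, y3, zpow_add₀ hq]
    simp only [star_add, star_mul, star_smul, conj_qc_zpow, smul_add, mul_smul_comm,
      smul_mul_assoc, smul_smul]
    match_scalars <;> field_simp
  · have e1 := congrArg (f * ·) y7
    have e2 := congrArg (· * g) x7
    have h3 := twist_twist_comm_plus g
    have h4 := twist_twist_comm_minus g
    simp only [y3, map_smul] at h3 h4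
    simp only [mul_sub, sub_mul, mul_smul_comm, smul_mul_assoc] at e1 e2
    rw [sub_eq_iff_eq_add] at e1 e2
    simp only [Dplus_mul, Dminus_mul, map_add, y3, map_smul, h3, h4, mul_smul_comm, e1, e2, weight_zpow_add, smul_add]
    match_scalars <;> field_simp <;> ring

theorem gen_mem_good (q : ℝˣ) (x : Gen) : gen q x ∈ good q (deg x) := by
  have hq := qc_ne q
  have ha := gen_mem_E q Gen.a
  have hb := gen_mem_E q Gen.b
  have hc := gen_mem_E q Gen.c
  have hd := gen_mem_E q Gen.d
  refine ⟨gen_mem_E q x, ?_, twist_gen x, ?_, ?_, ?_, ?_⟩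
  · cases x <;> simp only [star_a, star_b, star_c, star_d] <;>
      first
      | exact ha | exact hb | exact hc | exact hd
      | exact Submodule.smul_mem _ _ hb | exact Submodule.smul_mem _ _ hc
  · cases x <;> simp only [Dplus_a, Dplus_b, Dplus_c, Dplus_d] <;>
      first
      | exact zero_mem _
      | exact Submodule.smul_mem _ _ hb | exact Submodule.smul_mem _ _ hd
  · cases x <;> simp only [Dminus_a, Dminus_b, Dminus_c, Dminus_d] <;>
      first
      | exact zero_mem _
      | exact Submodule.smul_mem _ _ ha | exact Submodule.smul_mem _ _ hc
  · have h1 : star (qc q) = qc q := conj_qc q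
    have h2 : star Complex.I = -Complex.I := Complex.conj_I
    cases x <;>
      simp [star_a, star_b, star_c, star_d, star_smul, smul_smul, h1, h2, Dplus_a, Dplus_b,
        Dplus_c, Dplus_d, Dminus_a, Dminus_b, Dminus_c, Dminus_d, deg, pick] <;>
      match_scalars <;> field_simp <;> simp
  · have hinv : (weight q)⁻¹ 0 1 = -Complex.I := by
      simp [weight, Matrix.inv_def, Matrix.adjugate_fin_two, Matrix.det_fin_two]
      field_simp
    cases x <;>
      simp [Dplus_a, Dplus_b, Dplus_c, Dplus_d, Dminus_a, Dminus_b, Dminus_c, Dminus_d, deg,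
        pick, hinv, Matrix.zpow_neg_one] <;>
      (try simp [weight]) <;>
      match_scalars <;> field_simp

theorem algebraMap_mem_good (q : ℝˣ) (r : ℂ) : algebraMap ℂ (SUq q) r ∈ good q 0 := by
  refine ⟨algebraMap_mem_E q r, ?_, ?_, ?_, ?_, ?_, ?_⟩
  · rw [star_algebraMap_aux]
    exact algebraMap_mem_E q _
  all_goals simp [star_algebraMap_aux, Dplus_algebraMap, Dminus_algebraMap]

/-- The component of degree `k`. -/
def component (q : ℝˣ) (k : ℤ) : SUq q →ₗ[ℂ] SUq q :=
  (TensorProduct.rid ℂ (SUq q)).toLinearMap ∘ₗ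
    (LinearMap.lTensor (SUq q) ((Finsupp.lapply k : (ℤ →₀ ℂ) →ₗ[ℂ] ℂ) ∘ₗ
      (AddMonoidAlgebra.coeffLinearEquiv ℂ).toLinearMap)) ∘ₗ (coact q).toLinearMap

theorem component_of_mem {k l : ℤ} {f : SUq q} (hf : f ∈ E q l) :
    component q k f = if l = k then f else 0 := by
  rw [mem_E] at hf
  simp only [component, LinearMap.comp_apply, AlgHom.toLinearMap_apply, hf,
    LinearMap.lTensor_tmul]
  have h1 : AddMonoidAlgebra.coeffLinearEquiv ℂ (LaurentPolynomial.T l : LaurentPolynomial ℂ) =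
      Finsupp.single l 1 := rfl
  simp only [LinearEquiv.coe_coe, h1, Finsupp.lapply_apply, Finsupp.single_apply,
    TensorProduct.rid_tmul]
  split_ifs <;> simp

theorem iSup_good (q : ℝˣ) (f : SUq q) : f ∈ ⨆ k, good q k := by
  induction f using SUq.induction with
  | hs r => exact Submodule.mem_iSup_of_mem 0 (algebraMap_mem_good q r)
  | hg x => exact Submodule.mem_iSup_of_mem _ (gen_mem_good q x)
  | ha x y hx hy => exact add_mem hx hy
  | hm x y hx hy =>
    induction hx using Submodule.iSup_induction' with
    | mem k x hx =>
      induction hy using Submodule.iSup_induction' with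
      | mem l y hy => exact Submodule.mem_iSup_of_mem _ (mul_mem_good hx hy)
      | zero => simp
      | add y z _ _ h1 h2 => rw [mul_add]; exact add_mem h1 h2
    | zero => simp
    | add y z _ _ h1 h2 => rw [add_mul]; exact add_mem h1 h2

theorem good_of_mem {k : ℤ} {f : SUq q} (hf : f ∈ E q k) : f ∈ good q k := by
  have key : ∀ g ∈ ⨆ k, good q k, component q k g ∈ good q k := by
    intro g hg
    induction hg using Submodule.iSup_induction' with
    | mem l g hg =>
      rw [component_of_mem hg.1]
      split_ifs with h
      · exact h ▸ hg
      · exact zero_mem _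
    | zero => simp
    | add x y _ _ hx hy => rw [map_add]; exact add_mem hx hy
  simpa [component_of_mem hf] using key f (iSup_good q f)

theorem star_mem_E {k l : ℤ} {f : SUq q} (hf : f ∈ E q k) (h : l = -k) : star f ∈ E q l :=
  h ▸ (good_of_mem hf).2.1

theorem Dplus_mem_E {k l : ℤ} {f : SUq q} (hf : f ∈ E q k) (h : l = k + 2) :
    Dplus q f ∈ E q l := h ▸ (good_of_mem hf).2.2.2.1

theorem Dminus_mem_E {k l : ℤ} {f : SUq q} (hf : f ∈ E q k) (h : l = k - 2) :
    Dminus q f ∈ E q l := h ▸ (good_of_mem hf).2.2.2.2.1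

/-! ### The Haar functional

The monomials `aⁱ bʲ cᵏ` (`i ≥ 0`) and `d⁻ⁱ bʲ cᵏ` (`i < 0`) form a basis of the algebra. The
operators below describe left multiplication by the generators in this basis. -/

/-- The space with basis indexed by the monomials; `(i, j, k)` stands for `aⁱ bʲ cᵏ` if `i ≥ 0` and
for `d⁻ⁱ bʲ cᵏ` if `i ≤ 0`. -/
abbrev Mono : Type := (ℤ × ℕ × ℕ) →₀ ℂ

/-- Left multiplication by `a`. -/
def opA (q : ℝˣ) : Module.End ℂ Mono :=
  Finsupp.linearCombination ℂ fun x : ℤ × ℕ × ℕ =>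
    (Finsupp.single (x.1 + 1, x.2.1, x.2.2) 1 : Mono) +
      if x.1 < 0 then Finsupp.single (x.1 + 1, x.2.1 + 1, x.2.2 + 1) (qc q ^ (-2 * x.1 - 1)) else 0

/-- Left multiplication by `b`. -/
def opB (q : ℝˣ) : Module.End ℂ Mono :=
  Finsupp.linearCombination ℂ fun x : ℤ × ℕ × ℕ =>
    (Finsupp.single (x.1, x.2.1 + 1, x.2.2) (qc q ^ (-x.1)) : Mono)

/-- Left multiplication by `c`. -/
def opC (q : ℝˣ) : Module.End ℂ Mono :=
  Finsupp.linearCombination ℂ fun x : ℤ × ℕ × ℕ =>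
    (Finsupp.single (x.1, x.2.1, x.2.2 + 1) (qc q ^ (-x.1)) : Mono)

/-- Left multiplication by `d`. -/
def opD (q : ℝˣ) : Module.End ℂ Mono :=
  Finsupp.linearCombination ℂ fun x : ℤ × ℕ × ℕ =>
    (Finsupp.single (x.1 - 1, x.2.1, x.2.2) 1 : Mono) +
      if 0 < x.1 then Finsupp.single (x.1 - 1, x.2.1 + 1, x.2.2 + 1) (qc q ^ (1 - 2 * x.1)) else 0

theorem opB_single (i : ℤ) (j k : ℕ) (r : ℂ) : opB q (Finsupp.single (i, j, k) r) =
    Finsupp.single (i, j + 1, k) (qc q ^ (-i) * r) := by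
  simp [opB, mul_comm]

theorem opC_single (i : ℤ) (j k : ℕ) (r : ℂ) : opC q (Finsupp.single (i, j, k) r) =
    Finsupp.single (i, j, k + 1) (qc q ^ (-i) * r) := by
  simp [opC, mul_comm]

theorem opA_single (i : ℤ) (j k : ℕ) (r : ℂ) : opA q (Finsupp.single (i, j, k) r) =
    Finsupp.single (i + 1, j, k) r +
      Finsupp.single (i + 1, j + 1, k + 1) (if i < 0 then qc q ^ (-2 * i - 1) * r else 0) := by
  simp only [opA, Finsupp.linearCombination_single]
  split_ifs <;> simp [mul_comm]

theorem opD_single (i : ℤ) (j k : ℕ) (r : ℂ) : opD q (Finsupp.single (i, j, k) r) =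
    Finsupp.single (i - 1, j, k) r +
      Finsupp.single (i - 1, j + 1, k + 1) (if 0 < i then qc q ^ (1 - 2 * i) * r else 0) := by
  simp only [opD, Finsupp.linearCombination_single]
  split_ifs <;> simp [mul_comm]

theorem op_isTuple (q : ℝˣ) : IsTuple q (opA q) (opB q) (opC q) (opD q) := by
  have hq := qc_ne q
  have ad : ∀ i j k r, opA q (opD q (Finsupp.single (i, j, k) r)) =
      Finsupp.single (i, j, k) r +
        Finsupp.single (i, j + 1, k + 1) (qc q ^ (1 - 2 * i) * r) := by
    intro i j k r
    rcases lt_or_ge 0 i with h | h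
    · have h' : ¬ (i - 1 < 0) := by omega
      simp [opA_single, opD_single, h, h', -Finsupp.single_mul]
    · have h' : ¬ (0 < i) := by omega
      have h'' : i - 1 < 0 := by omega
      have e : -(2 * (i - 1)) - 1 = 1 - 2 * i := by ring
      simp [opA_single, opD_single, h', h'', e]
  have da : ∀ i j k r, opD q (opA q (Finsupp.single (i, j, k) r)) =
      Finsupp.single (i, j, k) r +
        Finsupp.single (i, j + 1, k + 1) (qc q ^ (-1 - 2 * i) * r) := by
    intro i j k r
    rcases lt_or_ge i 0 with h | h
    · have h' : ¬ (0 < i + 1) := by omega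
      have e : -(2 * i) - 1 = -1 - 2 * i := by ring
      simp [opA_single, opD_single, h, h', e, -Finsupp.single_mul]
    · have h' : ¬ (i < 0) := by omega
      have h'' : 0 < i + 1 := by omega
      have e : 1 - 2 * (i + 1) = -1 - 2 * i := by ring
      simp [opA_single, opD_single, h', h'', e]
  have p1 : ∀ n : ℤ, qc q * qc q ^ n = qc q ^ (n + 1) := fun n => by
    rw [zpow_add_one₀ hq, mul_comm]
  constructor <;> refine Finsupp.lhom_ext ?_ <;> rintro ⟨i, j, k⟩ r
  · simp only [Module.End.mul_apply, LinearMap.smul_apply, opA_single, opB_single, map_add,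
      smul_add, Finsupp.smul_single, smul_eq_mul, ← mul_assoc, p1]
    congr 2
    · congr 2; ring
    · split_ifs <;> simp only [mul_zero, ← mul_assoc, mul_comm r, ← zpow_add₀ hq, p1]
      congr 2; ring
  · simp only [Module.End.mul_apply, LinearMap.smul_apply, opA_single, opC_single, map_add,
      smul_add, Finsupp.smul_single, smul_eq_mul, ← mul_assoc, p1]
    congr 2
    · congr 2; ring
    · split_ifs <;> simp only [mul_zero, ← mul_assoc, mul_comm r, ← zpow_add₀ hq, p1]
      congr 2; ring
  · simp only [Module.End.mul_apply, LinearMap.smul_apply, opD_single, opB_single, map_add,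
      smul_add, Finsupp.smul_single, smul_eq_mul, ← mul_assoc, p1]
    congr 2
    · congr 2; ring
    · split_ifs <;> simp only [mul_zero, ← mul_assoc, mul_comm r, ← zpow_add₀ hq, p1]
      congr 2; ring
  · simp only [Module.End.mul_apply, LinearMap.smul_apply, opD_single, opC_single, map_add,
      smul_add, Finsupp.smul_single, smul_eq_mul, ← mul_assoc, p1]
    congr 2
    · congr 2; ring
    · split_ifs <;> simp only [mul_zero, ← mul_assoc, mul_comm r, ← zpow_add₀ hq, p1]
      congr 2; ring
  · simp only [Module.End.mul_apply, opB_single, opC_single]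
  · simp only [Module.End.mul_apply, LinearMap.sub_apply, LinearMap.smul_apply, ad, da, opB_single,
      opC_single, add_sub_add_left_eq_sub, ← Finsupp.single_sub, Finsupp.smul_single, smul_eq_mul]
    congr 1
    rw [sub_eq_add_neg 1, sub_eq_add_neg (-1 : ℤ), zpow_add₀ hq, zpow_add₀ hq,
      show -(2 * i) = -i + -i by ring, zpow_add₀ hq, zpow_one, zpow_neg_one]
    ring
  · simp only [Module.End.mul_apply, LinearMap.sub_apply, LinearMap.smul_apply, ad, opB_single,
      opC_single, Finsupp.smul_single, smul_eq_mul, Module.End.one_apply]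
    rw [add_sub_assoc, ← Finsupp.single_sub, sub_eq_add_neg 1, zpow_add₀ hq,
      show -(2 * i) = -i + -i by ring, zpow_add₀ hq, zpow_one]
    ring_nf
    simp

/-- The coordinates of an element in the monomial basis. -/
def normalForm (q : ℝˣ) : SUq q →ₗ[ℂ] Mono :=
  (LinearMap.applyₗ (Finsupp.single ((0 : ℤ), 0, 0) 1 : Mono)) ∘ₗ
    (lift (op_isTuple q)).toLinearMap

/-- The `q`-integer `[n] = qⁿ⁻¹ + qⁿ⁻³ + ⋯ + q¹⁻ⁿ`. -/
def qInt (q : ℝˣ) (n : ℕ) : ℂ := ∑ r ∈ Finset.range n, qc q ^ ((n : ℤ) - 1 - 2 * r)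

/-- The Haar functional of quantum `SU(2)`, i.e. the functional `h` with `h(1) = 1` and
`(id ⊗ h) Δ = h(·) 1 = (h ⊗ id) Δ`, by its values on the basis: it sends `(bc)ⁿ` to `(-1)ⁿ / [n + 1]` and every other
basis monomial to `0`. -/
def haar (q : ℝˣ) : SUq q →ₗ[ℂ] ℂ :=
  (Finsupp.linearCombination ℂ fun x : ℤ × ℕ × ℕ =>
    if x.1 = 0 ∧ x.2.1 = x.2.2 then (-1) ^ x.2.1 / qInt q (x.2.1 + 1) else 0) ∘ₗ normalForm q

theorem normalForm_a (q : ℝˣ) (i j k : ℕ) :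
    normalForm q (gen q Gen.a ^ i * gen q Gen.b ^ j * gen q Gen.c ^ k) =
      Finsupp.single ((i : ℤ), j, k) 1 := by
  have hc : ∀ k : ℕ, (opC q ^ k) (Finsupp.single ((0 : ℤ), 0, 0) 1) =
      Finsupp.single ((0 : ℤ), 0, k) 1 := by
    intro k
    induction k with
    | zero => simp
    | succ k ih => rw [pow_succ', Module.End.mul_apply, ih, opC_single]; simp
  have hb : ∀ j : ℕ, (opB q ^ j) (Finsupp.single ((0 : ℤ), 0, k) 1) =
      Finsupp.single ((0 : ℤ), j, k) 1 := by
    intro j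
    induction j with
    | zero => simp
    | succ k ih => rw [pow_succ', Module.End.mul_apply, ih, opB_single]; simp
  have ha : ∀ i : ℕ, (opA q ^ i) (Finsupp.single ((0 : ℤ), j, k) 1) =
      Finsupp.single ((i : ℤ), j, k) 1 := by
    intro i
    induction i with
    | zero => simp
    | succ i ih =>
      have : ¬ ((i : ℤ) < 0) := by omega
      rw [pow_succ', Module.End.mul_apply, ih, opA_single]; simp
  simp [normalForm, pick, hc, hb, ha]

theorem normalForm_d (q : ℝˣ) (i j k : ℕ) :
    normalForm q (gen q Gen.d ^ i * gen q Gen.b ^ j * gen q Gen.c ^ k) =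
      Finsupp.single (-(i : ℤ), j, k) 1 := by
  have hd : ∀ i : ℕ, (opD q ^ i) (Finsupp.single ((0 : ℤ), j, k) 1) =
      Finsupp.single (-(i : ℤ), j, k) 1 := by
    intro i
    induction i with
    | zero => simp
    | succ i ih =>
      have h : ¬ (0 < -(i : ℤ)) := by omega
      have e : -(i : ℤ) - 1 = -1 + -(i : ℤ) := by ring
      rw [pow_succ', Module.End.mul_apply, ih, opD_single]; simp [e]
  have h := normalForm_a q 0 j k
  simp only [normalForm, LinearMap.comp_apply, AlgHom.toLinearMap_apply, map_mul, map_pow,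
    LinearMap.applyₗ_apply_apply, lift_gen, pick, pow_zero, one_mul, mul_assoc,
    Module.End.mul_apply] at h ⊢
  rw [h]
  exact hd i

theorem haar_a (q : ℝˣ) (i j k : ℕ) :
    haar q (gen q Gen.a ^ i * gen q Gen.b ^ j * gen q Gen.c ^ k) =
      if i = 0 ∧ j = k then (-1) ^ j / qInt q (j + 1) else 0 := by
  simp [haar, normalForm_a]

theorem haar_d (q : ℝˣ) (i j k : ℕ) :
    haar q (gen q Gen.d ^ i * gen q Gen.b ^ j * gen q Gen.c ^ k) =
      if i = 0 ∧ j = k then (-1) ^ j / qInt q (j + 1) else 0 := by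
  simp [haar, normalForm_d]

/-! ### The differential forms on the quantum sphere -/

/-- The differential forms `(m, f, g, t)`, standing for `m + f e⁺ + g e⁻ + t τ`, where `m` and `t`
have degree `0`, `f` has degree `2` and `g` has degree `-2`. Here `e⁺` is the class of `d(cd)`, `e⁻`
is `i q⁻¹` times the class of `d(ab)`, and `τ = i q⁻¹ [d(cd) ∧ d(ab)]`; see `del`, `delbar`, `wedge`
for the structure maps of the calculus. -/
abbrev Forms (q : ℝˣ) : Type := E q 0 × E q 2 × E q (-2) × E q 0

/-- The map `D₊` from degree `k` to degree `l = k + 2`. -/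
def Dp (q : ℝˣ) (k l : ℤ) (h : l = k + 2) : E q k →ₗ[ℂ] E q l :=
  (Dplus q).restrict fun _ hf => Dplus_mem_E hf h

/-- The map `D₋` from degree `k` to degree `l = k - 2`. -/
def Dm (q : ℝˣ) (k l : ℤ) (h : l = k - 2) : E q k →ₗ[ℂ] E q l :=
  (Dminus q).restrict fun _ hf => Dminus_mem_E hf h

/-- The holomorphic differential: `∂ m = (D₊ m) e⁺`, `∂ (g e⁻) = q² (D₊ g) τ`, and `∂ = 0` on
`(1, 0)`-forms and on `2`-forms. -/
def del (q : ℝˣ) : Forms q →ₗ[ℂ] Forms q where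
  toFun ω := (0, Dp q 0 2 rfl ω.1, 0, qc q ^ 2 • Dp q (-2) 0 rfl ω.2.2.1)
  map_add' ω ν := by simp
  map_smul' r ω := by simp [smul_comm r]

/-- The anti-holomorphic differential: `∂̄ m = (D₋ m) e⁻`, `∂̄ (f e⁺) = -(D₋ f) τ`, and `∂̄ = 0` on
`(0, 1)`-forms and on `2`-forms. -/
def delbar (q : ℝˣ) : Forms q →ₗ[ℂ] Forms q where
  toFun ω := (0, 0, Dm q 0 (-2) rfl ω.1, -Dm q 2 0 rfl ω.2.1)
  map_add' ω ν := by simp [add_comm]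
  map_smul' r ω := by simp

/-- The exterior differential `d = ∂ + ∂̄`. -/
def extd (q : ℝˣ) : Forms q →ₗ[ℂ] Forms q := del q + delbar q

/-- The product of homogeneous elements. -/
def mulE {k l : ℤ} (m : ℤ) (f : E q k) (g : E q l) (h : m = k + l) : E q m :=
  ⟨(f : SUq q) * g, mul_mem_E f.2 g.2 h⟩

/-- The involution on homogeneous elements. -/
def starE {k : ℤ} (l : ℤ) (f : E q k) (h : l = -k) : E q l := ⟨star (f : SUq q), star_mem_E f.2 h⟩

/-- The wedge product: `f e⁺ ∧ g e⁻ = f g τ`, `g e⁻ ∧ f e⁺ = -q² g f τ`,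
`e^± ∧ e^± = 0`. -/
def wedge (ω ν : Forms q) : Forms q :=
  (mulE 0 ω.1 ν.1 rfl,
   mulE 2 ω.1 ν.2.1 rfl + mulE 2 ω.2.1 ν.1 rfl,
   mulE (-2) ω.1 ν.2.2.1 rfl + mulE (-2) ω.2.2.1 ν.1 rfl,
   mulE 0 ω.1 ν.2.2.2 rfl + mulE 0 ω.2.2.2 ν.1 rfl + mulE 0 ω.2.1 ν.2.2.1 rfl -
     qc q ^ 2 • mulE 0 ω.2.2.1 ν.2.1 rfl)

/-- The `*`-involution on forms: `(f e⁺)* = i f* e⁻`, `(g e⁻)* = i g* e⁺`, `(t τ)* = t* τ`. -/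
def conjForm (ω : Forms q) : Forms q :=
  (starE 0 ω.1 rfl, Complex.I • starE 2 ω.2.2.1 rfl, Complex.I • starE (-2) ω.2.1 rfl,
    starE 0 ω.2.2.2 rfl)

/-- The parity operator, multiplying `k`-forms by `(-1)ᵏ`. -/
def parity (ω : Forms q) : Forms q := (ω.1, -ω.2.1, -ω.2.2.1, ω.2.2.2)

/-- The Hodge map: `*1 = τ`, `*τ = 1`, `*e⁺ = i e⁺`, `*e⁻ = -i e⁻`. -/
def hodge (q : ℝˣ) : Forms q →ₗ[ℂ] Forms q where
  toFun ω := (ω.2.2.2, Complex.I • ω.2.1, -(Complex.I • ω.2.2.1), ω.1)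
  map_add' ω ν := by simp [add_comm]
  map_smul' r ω := by simp [smul_comm r]

/-- The metric, sesquilinear with values in the quantum sphere: forms of different bidegree are
orthogonal, and `g(m, n) = m n*`, `g(f e⁺, h e⁺) = f h*`, `g(f e⁻, h e⁻) = q² f h*`,
`g(s τ, t τ) = s t*`. -/
def metric (ω ν : Forms q) : E q 0 :=
  mulE 0 ω.1 (starE 0 ν.1 rfl) rfl + mulE 0 ω.2.1 (starE (-2) ν.2.1 rfl) rfl +
    qc q ^ 2 • mulE 0 ω.2.2.1 (starE 2 ν.2.2.1 rfl) rfl +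
    mulE 0 ω.2.2.2 (starE 0 ν.2.2.2 rfl) rfl

/-- The `2`-form `t τ`. -/
def topForm (t : E q 0) : Forms q := (0, 0, 0, t)

/-- The integral `∫ t τ = h(t)`, where `h` is the Haar functional; it vanishes on forms of degree
less than `2`. -/
def integral (q : ℝˣ) : Forms q →ₗ[ℂ] ℂ where
  toFun ω := haar q ω.2.2.2
  map_add' ω ν := by simp
  map_smul' r ω := by simp

/-- The inner product `⟨ω, ν⟩ = ∫ g(ω, ν) τ`. -/
def innerProd (ω ν : Forms q) : ℂ := integral q (topForm (metric ω ν))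

/-- `S` is an adjoint of `T`. -/
def IsAdjoint (T S : Forms q →ₗ[ℂ] Forms q) : Prop :=
  ∀ ω ν, innerProd (T ω) ν = innerProd ω (S ν)

/-! ### The forms are a differential `*`-algebra, and the Hodge map is the one of the metric -/

theorem extd_extd (ω : Forms q) : extd q (extd q ω) = 0 := by
  have h : Dminus q (Dplus q ω.1) = qc q ^ 2 • Dplus q (Dminus q ω.1) := by
    simpa [sub_eq_zero] using (good_of_mem ω.1.2).2.2.2.2.2.2
  refine Prod.ext ?_ (Prod.ext ?_ (Prod.ext ?_ ?_)) <;> apply Subtype.ext <;>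
    simp [extd, del, delbar, Dp, Dm, h]

theorem extd_wedge (ω ν : Forms q) :
    extd q (wedge ω ν) = wedge (extd q ω) ν + wedge (parity ω) (extd q ν) := by
  have h0 : ∀ f : E q 0, twist q (f : SUq q) = f := fun f => by
    simpa using (good_of_mem f.2).2.2.1
  have h1 : ∀ f : E q 2, twist q (f : SUq q) = qc q ^ 2 • (f : SUq q) := fun f =>
    (good_of_mem f.2).2.2.1
  have h2 : ∀ f : E q (-2), twist q (f : SUq q) = (qc q ^ 2)⁻¹ • (f : SUq q) := fun f =>
    (good_of_mem f.2).2.2.1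
  have hq := qc_ne q
  refine Prod.ext ?_ (Prod.ext ?_ (Prod.ext ?_ ?_)) <;> apply Subtype.ext <;>
    simp [extd, del, delbar, Dp, Dm, wedge, mulE, parity, Dplus_mul, Dminus_mul, h0, h1, h2]
  · abel
  · abel
  · simp only [add_mul, mul_add, smul_mul_assoc, mul_smul_comm, neg_mul, mul_neg]
    match_scalars <;> field_simp

theorem conjForm_wedge_one (f f' : E q 2) (g g' : E q (-2)) :
    conjForm (wedge (0, f, g, 0) (0, f', g', 0)) =
      -wedge (conjForm (0, f', g', 0)) (conjForm (0, f, g, 0)) := by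
  have h1 : star (qc q) = qc q := conj_qc q
  have hI : Complex.I * Complex.I = -1 := Complex.I_mul_I
  refine Prod.ext ?_ (Prod.ext ?_ (Prod.ext ?_ ?_)) <;> apply Subtype.ext <;>
    simp only [wedge, conjForm, mulE, starE, Prod.neg_mk, Submodule.coe_add,
      AddSubgroupClass.coe_sub, Submodule.coe_smul, ZeroMemClass.coe_zero, Submodule.coe_neg,
      star_zero, star_add, star_sub, star_smul, star_mul, zero_mul, mul_zero, add_zero, zero_add,
      smul_zero, neg_zero, smul_mul_assoc, mul_smul_comm, smul_smul, hI, h1, star_pow] <;>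
    module

theorem conjForm_wedge_even (m t : E q 0) (ω : Forms q) :
    conjForm (wedge (m, 0, 0, t) ω) = wedge (conjForm ω) (conjForm (m, 0, 0, t)) ∧
      conjForm (wedge ω (m, 0, 0, t)) = wedge (conjForm (m, 0, 0, t)) (conjForm ω) := by
  constructor <;> refine Prod.ext ?_ (Prod.ext ?_ (Prod.ext ?_ ?_)) <;> apply Subtype.ext <;>
    simp only [wedge, conjForm, mulE, starE, Submodule.coe_add, AddSubgroupClass.coe_sub,
      Submodule.coe_smul, ZeroMemClass.coe_zero, star_zero, star_add, star_sub, star_smul,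
      star_mul, zero_mul, mul_zero, add_zero, zero_add, smul_zero, sub_zero, smul_mul_assoc,
      mul_smul_comm] <;>
    abel

theorem extd_conjForm (ω : Forms q) : extd q (conjForm ω) = conjForm (extd q ω) := by
  have hI : Complex.I * Complex.I = -1 := Complex.I_mul_I
  have h1 : star (qc q) = qc q := conj_qc q
  have hq := qc_ne q
  have key : ∀ (k : ℤ) (f : E q k), Dplus q (star (f : SUq q)) =
      (Complex.I * (qc q ^ k)⁻¹) • star (Dminus q f) := fun k f =>
    (good_of_mem f.2).2.2.2.2.2.1
  have key' : ∀ (k : ℤ) (f : E q k), Dminus q (star (f : SUq q)) =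
      (Complex.I * (qc q ^ k)⁻¹) • star (Dplus q f) := fun k f => by
    have h := (good_of_mem (star_mem_E f.2 rfl)).2.2.2.2.2.1
    rw [star_star] at h
    rw [h, star_smul, star_star, smul_smul]
    have e : star (Complex.I * (qc q ^ (-k))⁻¹) = -(Complex.I * qc q ^ k) := by
      have h2 : star Complex.I = -Complex.I := Complex.conj_I
      rw [zpow_neg, inv_inv, star_mul', conj_qc_zpow, h2, neg_mul]
    have e2 : Complex.I * (qc q ^ k)⁻¹ * -(Complex.I * qc q ^ k) = 1 := by
      have := zpow_ne_zero k hq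
      field_simp
      simp
    rw [e, e2, one_smul]
  have kp := key 0 ω.1
  have km := key' 0 ω.1
  have kp2 := key 2 ω.2.1
  have km2 := key' (-2) ω.2.2.1
  simp only [zpow_zero, inv_one, mul_one, zpow_neg, inv_inv] at kp km kp2 km2
  refine Prod.ext ?_ (Prod.ext ?_ (Prod.ext ?_ ?_)) <;> apply Subtype.ext <;>
    simp only [extd, del, delbar, Dp, Dm, conjForm, starE, LinearMap.add_apply, LinearMap.coe_mk,
      AddHom.coe_mk, Prod.mk_add_mk, LinearMap.coe_restrict_apply, Submodule.coe_add,
      Submodule.coe_smul, ZeroMemClass.coe_zero, Submodule.coe_neg, map_smul, kp, km, kp2, km2,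
      star_zero, star_add, star_neg, star_smul, add_zero, zero_add, smul_smul, h1, star_pow] <;>
    match_scalars <;> field_simp <;> simp

theorem metric_top (ω ν : Forms q) :
    topForm (metric ω ν) = (0, 0, 0, (wedge ω (hodge q (conjForm ν))).2.2.2) := by
  refine Prod.ext rfl (Prod.ext rfl (Prod.ext rfl ?_)) 
  apply Subtype.ext
  simp [topForm, metric, wedge, hodge, conjForm, mulE, starE, smul_smul]
  abel

theorem hodge_conjForm (ω : Forms q) : hodge q (conjForm ω) = conjForm (hodge q ω) := by
  refine Prod.ext ?_ (Prod.ext ?_ (Prod.ext ?_ ?_)) <;> apply Subtype.ext <;>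
    simp [hodge, conjForm, starE, smul_smul]

end Podles

end

noncomputable section

namespace Podles

open scoped TensorProduct ComplexConjugate

variable {q : ℝˣ}

/-! ### Quantum integers -/

/-! Existence of the adjoints is integration by parts. The Haar functional annihilates the images of
`Dplus` and `Dminus` (`haar_Dplus`, `haar_Dminus`), so the twisted Leibniz rule gives `h(x D g) =
-qᵏ h((D x) g)` for `g` of degree `k`. The involution exchanges the two derivations up to the factor
`-i qᵏ` (`star_Dminus`, `star_Dplus`). Hence moving `D₊` across the inner product produces `D₋`, and
conversely. The factors `±i` are those of the Hodge map, and the powers of `q` cancel against the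
weight `q²` of `e⁻` in the metric and the `q²` in `∂(g e⁻)`.

The vanishing of `h ∘ D₊` is computed in the monomial basis: `D₊` of a monomial is a combination of
at most two monomials (`Dplus_monomial`), and their Haar values cancel. For `D₋` it follows by
applying the involution.

Uniqueness is nondegeneracy of the inner product, which is proved algebraically, without positivity
of `h`. The left ideal `haarKer` of all `g` with `h(f g) = 0` for every `f` contains `D₊ g` and `D₋
g` along with each homogeneous `g`. Since `D₊` is locally nilpotent, it suffices to treat
homogeneous `g` in the ideal with `D₊ g = 0`. In negative degree such `g` vanish, because the kernel
of `D₊` is spanned by the monomials `dⁱ bʲ`, of degree `i + j`. In degree `0` they are scalars,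
killed by `h(1) = 1`. In positive degree, the commutation relation of `D₊` and `D₋` makes `D₊ D₋ g`
a nonzero multiple of `g`. Correcting `a g` and `c g` by multiples of `b D₋ g` and `d D₋ g` gives
elements of the same kind in one degree less. These vanish by induction, and the relation `d a - q⁻¹
b c = 1` then recovers `g = 0`. -/

theorem qInt_eq_ofReal (q : ℝˣ) (n : ℕ) :
    qInt q n = ((∑ r ∈ Finset.range n, (q : ℝ) ^ ((n : ℤ) - 1 - 2 * r) : ℝ) : ℂ) := by
  simp [qInt, qc]

theorem conj_qInt (q : ℝˣ) (n : ℕ) : conj (qInt q n) = qInt q n := by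
  rw [qInt_eq_ofReal, Complex.conj_ofReal]

theorem qInt_zero (q : ℝˣ) : qInt q 0 = 0 := by simp [qInt]

theorem qInt_one (q : ℝˣ) : qInt q 1 = 1 := by simp [qInt]

/-- Split the defining sum after its first `m` terms. This identity merges the two contributions to
`D₊(aⁿ bʲ cᵏ)` in `Dplus_monomial`. -/
theorem qInt_add (q : ℝˣ) (m n : ℕ) :
    qInt q (m + n) = qc q ^ n * qInt q m + (qc q ^ m)⁻¹ * qInt q n := by
  have hq := qc_ne q
  simp only [qInt, Finset.sum_range_add, Finset.mul_sum]
  congr 1 <;> refine Finset.sum_congr rfl fun r _ => ?_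
  · rw [← zpow_natCast, ← zpow_add₀ hq]
    congr 1
    push_cast
    ring
  · rw [← zpow_natCast, ← zpow_neg, ← zpow_add₀ hq]
    congr 1
    push_cast
    ring

/-- Reality of `q` enters here: `[n + 1]` is `qⁿ` times a sum of powers of `q⁻²`, all positive even
when `q < 0`. Roots of unity other than `±1` are thereby excluded. -/
theorem qInt_succ_ne_zero (q : ℝˣ) (n : ℕ) : qInt q (n + 1) ≠ 0 := by
  have hq : (q : ℝ) ≠ 0 := q.ne_zero
  rw [qInt_eq_ofReal, Complex.ofReal_ne_zero]
  have h : ∀ r : ℕ, (q : ℝ) ^ (((n + 1 : ℕ) : ℤ) - 1 - 2 * r) =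
      (q : ℝ) ^ n * (((q : ℝ) ^ 2) ^ r)⁻¹ := by
    intro r
    rw [← pow_mul, ← zpow_natCast, ← zpow_natCast, ← zpow_neg, ← zpow_add₀ hq]
    congr 1
    push_cast
    ring
  simp only [h, ← Finset.mul_sum]
  refine mul_ne_zero (pow_ne_zero _ hq) (ne_of_gt ?_)
  exact Finset.sum_pos (fun r _ => by positivity) (by simp)

/-! ### Commutation of powers -/

section
variable {A : Type*} [Ring A] [Algebra ℂ A]

theorem mul_pow_of_comm {x y : A} {r : ℂ} (h : x * y = r • (y * x)) (n : ℕ) :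
    x * y ^ n = r ^ n • (y ^ n * x) := by
  induction n with
  | zero => simp
  | succ n ih =>
    rw [pow_succ, ← mul_assoc, ih, smul_mul_assoc, mul_assoc, h, mul_smul_comm, smul_smul,
      pow_succ, mul_assoc]

theorem pow_mul_of_comm {x y : A} {r : ℂ} (h : x * y = r • (y * x)) (n : ℕ) :
    x ^ n * y = r ^ n • (y * x ^ n) := by
  induction n with
  | zero => simp
  | succ n ih =>
    rw [pow_succ', mul_assoc, ih, mul_smul_comm, ← mul_assoc, h, smul_mul_assoc, smul_smul,
      mul_assoc, pow_succ]

theorem pow_mul_pow_of_comm {x y : A} {r : ℂ} (h : x * y = r • (y * x)) (m n : ℕ) :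
    x ^ m * y ^ n = (r ^ n) ^ m • (y ^ n * x ^ m) :=
  pow_mul_of_comm (mul_pow_of_comm h n) m
end

/-! ### The monomial basis -/

/-- The monomial `aⁱ bʲ cᵏ` for `i ≥ 0`, and `d⁻ⁱ bʲ cᵏ` for `i ≤ 0`. -/
def monomial (q : ℝˣ) (x : ℤ × ℕ × ℕ) : SUq q :=
  gen q Gen.a ^ x.1.toNat * gen q Gen.d ^ (-x.1).toNat * gen q Gen.b ^ x.2.1 * gen q Gen.c ^ x.2.2

theorem monomial_nat (q : ℝˣ) (i j k : ℕ) : monomial q ((i : ℤ), j, k) =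
    gen q Gen.a ^ i * gen q Gen.b ^ j * gen q Gen.c ^ k := by
  simp [monomial]

theorem monomial_neg (q : ℝˣ) (i j k : ℕ) : monomial q (-(i : ℤ), j, k) =
    gen q Gen.d ^ i * gen q Gen.b ^ j * gen q Gen.c ^ k := by
  simp [monomial]

theorem normalForm_monomial (q : ℝˣ) (x : ℤ × ℕ × ℕ) :
    normalForm q (monomial q x) = Finsupp.single x 1 := by
  obtain ⟨i, j, k⟩ := x
  obtain ⟨n, rfl | rfl⟩ := i.eq_nat_or_neg
  · rw [monomial_nat, normalForm_a]
  · rw [monomial_neg, normalForm_d]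

theorem haar_monomial (q : ℝˣ) (x : ℤ × ℕ × ℕ) : haar q (monomial q x) =
    if x.1 = 0 ∧ x.2.1 = x.2.2 then (-1) ^ x.2.1 / qInt q (x.2.1 + 1) else 0 := by
  simp [haar, normalForm_monomial]

/-- The element with given coordinates in the monomial basis. -/
def ofNormalForm (q : ℝˣ) : Mono →ₗ[ℂ] SUq q := Finsupp.linearCombination ℂ (monomial q)

theorem ofNormalForm_single (x : ℤ × ℕ × ℕ) (r : ℂ) :
    ofNormalForm q (Finsupp.single x r) = r • monomial q x := by
  simp [ofNormalForm]

theorem gen_b_mul_monomial (n : ℤ) (j k : ℕ) :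
    gen q Gen.b * monomial q (n, j, k) = qc q ^ (-n) • monomial q (n, j + 1, k) := by
  obtain ⟨i, rfl | rfl⟩ := n.eq_nat_or_neg
  · simp only [monomial_nat, ← mul_assoc, mul_pow_of_comm ba, pow_succ', smul_mul_assoc]
    simp
  · simp only [monomial_neg, ← mul_assoc, mul_pow_of_comm (gen_isTuple q).bd, pow_succ',
      smul_mul_assoc]
    simp

theorem pow_c_mul_pow_b (j k : ℕ) : gen q Gen.c ^ k * gen q Gen.b ^ j =
    gen q Gen.b ^ j * gen q Gen.c ^ k :=
  ((show Commute (gen q Gen.c) (gen q Gen.b) from cb).pow_pow k j).eq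

theorem gen_c_mul_monomial (n : ℤ) (j k : ℕ) :
    gen q Gen.c * monomial q (n, j, k) = qc q ^ (-n) • monomial q (n, j, k + 1) := by
  have h := pow_c_mul_pow_b (q := q) j 1
  rw [pow_one] at h
  obtain ⟨i, rfl | rfl⟩ := n.eq_nat_or_neg
  · simp only [monomial_nat, ← mul_assoc, mul_pow_of_comm ca, pow_succ', smul_mul_assoc]
    rw [mul_assoc (_ ^ i), h]
    simp [mul_assoc]
  · simp only [monomial_neg, ← mul_assoc, mul_pow_of_comm (gen_isTuple q).cd, pow_succ',
      smul_mul_assoc]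
    rw [mul_assoc (_ ^ i), h]
    simp [mul_assoc]

theorem b_mul_c_mul_pow (j k : ℕ) : gen q Gen.b * (gen q Gen.c *
    (gen q Gen.b ^ j * gen q Gen.c ^ k)) = gen q Gen.b ^ (j + 1) * gen q Gen.c ^ (k + 1) := by
  have h := pow_c_mul_pow_b (q := q) j 1
  rw [pow_one] at h
  rw [← mul_assoc (gen q Gen.c), h, pow_succ' _ j, pow_succ' _ k]
  simp only [mul_assoc]

theorem bc_mul_pow_d (i : ℕ) : gen q Gen.b * gen q Gen.c * gen q Gen.d ^ i =
    (qc q ^ (2 * i)) • (gen q Gen.d ^ i * (gen q Gen.b * gen q Gen.c)) := by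
  rw [mul_assoc, mul_pow_of_comm (gen_isTuple q).cd, mul_smul_comm, ← mul_assoc,
    mul_pow_of_comm (gen_isTuple q).bd, smul_mul_assoc, smul_smul, mul_assoc, ← pow_add, two_mul]

theorem bc_mul_pow_a (i : ℕ) : gen q Gen.b * gen q Gen.c * gen q Gen.a ^ i =
    ((qc q)⁻¹ ^ (2 * i)) • (gen q Gen.a ^ i * (gen q Gen.b * gen q Gen.c)) := by
  rw [mul_assoc, mul_pow_of_comm ca, mul_smul_comm, ← mul_assoc,
    mul_pow_of_comm ba, smul_mul_assoc, smul_smul, mul_assoc, ← pow_add, two_mul]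

/-- For `n = -(i + 1)`, the product `a d` equals `1 + q b c`, and moving `b c` past `dⁱ` costs
`q²ⁱ`; together this is the exponent `-2n - 1 = 2i + 1`. -/
theorem gen_a_mul_monomial (n : ℤ) (j k : ℕ) :
    gen q Gen.a * monomial q (n, j, k) = monomial q (n + 1, j, k) +
      (if n < 0 then qc q ^ (-2 * n - 1) else 0) • monomial q (n + 1, j + 1, k + 1) := by
  have hq := qc_ne q
  obtain ⟨i, rfl | rfl⟩ := n.eq_nat_or_neg
  · have h : ¬ ((i : ℤ) < 0) := by omega
    simp only [h, if_false, zero_smul, add_zero, ← Nat.cast_succ, monomial_nat, pow_succ', mul_assoc]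
  · cases i with
    | zero =>
      simp [monomial, mul_assoc]
    | succ i =>
      have h : (-((i + 1 : ℕ) : ℤ) < 0) := by omega
      have e : -((i + 1 : ℕ) : ℤ) + 1 = -(i : ℤ) := by push_cast; ring
      have e2 : (-2 * -((i + 1 : ℕ) : ℤ) - 1) = ((2 * i + 1 : ℕ) : ℤ) := by push_cast; ring
      simp only [h, if_true, e, e2, monomial_neg, zpow_natCast]
      rw [pow_succ' _ i, ← mul_assoc, ← mul_assoc, ← mul_assoc, ad, add_mul, one_mul,
        smul_mul_assoc, bc_mul_pow_d, add_mul, add_mul, smul_smul, ← pow_succ', smul_mul_assoc,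
        smul_mul_assoc]
      simp only [mul_assoc, b_mul_c_mul_pow]

theorem gen_d_mul_monomial (n : ℤ) (j k : ℕ) :
    gen q Gen.d * monomial q (n, j, k) = monomial q (n - 1, j, k) +
      (if 0 < n then qc q ^ (1 - 2 * n) else 0) • monomial q (n - 1, j + 1, k + 1) := by
  have hq := qc_ne q
  obtain ⟨i, rfl | rfl⟩ := n.eq_nat_or_neg
  · cases i with
    | zero =>
      have := monomial_neg q 1 j k
      simp only [Nat.cast_one] at this
      simp [this]
      simp [monomial, mul_assoc]
    | succ i =>
      have h : (0 < ((i + 1 : ℕ) : ℤ)) := by omega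
      have e : ((i + 1 : ℕ) : ℤ) - 1 = (i : ℤ) := by push_cast; ring
      have e2 : (1 - 2 * ((i + 1 : ℕ) : ℤ)) = -((2 * i + 1 : ℕ) : ℤ) := by push_cast; ring
      simp only [h, if_true, e, e2, monomial_nat, zpow_neg, zpow_natCast, ← inv_pow]
      rw [pow_succ' _ i, ← mul_assoc, ← mul_assoc, ← mul_assoc, da, add_mul, one_mul,
        smul_mul_assoc, bc_mul_pow_a, add_mul, add_mul, smul_smul, ← pow_succ', smul_mul_assoc,
        smul_mul_assoc]
      simp only [mul_assoc, b_mul_c_mul_pow]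
  · have h : ¬ (0 < -(i : ℤ)) := by omega
    have e : -(i : ℤ) - 1 = -((i + 1 : ℕ) : ℤ) := by push_cast; ring
    simp only [h, if_false, zero_smul, add_zero, e, monomial_neg, pow_succ', mul_assoc]

/-- The operators `opA`, …, `opD` were designed to model left multiplication on monomials.
Evaluating this intertwining relation at the monomial `1` shows that the monomials span; their
independence comes from `normalForm_monomial`. -/
theorem ofNormalForm_lift (f : SUq q) (m : Mono) :
    ofNormalForm q (lift (op_isTuple q) f m) = f * ofNormalForm q m := by
  induction f using SUq.induction generalizing m with
  | hs r => simp [Module.algebraMap_end_apply, Algebra.smul_def]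
  | hm x y hx hy => rw [map_mul, Module.End.mul_apply, hx, hy, mul_assoc]
  | ha x y hx hy => rw [map_add, LinearMap.add_apply, map_add, hx, hy, add_mul]
  | hg x =>
    induction m using Finsupp.induction_linear with
    | zero => simp
    | add m n hm hn => simp only [map_add, mul_add, hm, hn]
    | single y r =>
      obtain ⟨n, j, k⟩ := y
      cases x <;>
        simp only [lift_gen, pick, opA_single, opB_single, opC_single, opD_single, map_add,
          ofNormalForm_single, mul_smul_comm, gen_a_mul_monomial, gen_b_mul_monomial,
          gen_c_mul_monomial, gen_d_mul_monomial, smul_add, smul_smul, mul_comm r, ite_mul,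
          zero_mul]

@[simp] theorem ofNormalForm_normalForm (f : SUq q) : ofNormalForm q (normalForm q f) = f := by
  have h := ofNormalForm_lift f (Finsupp.single ((0 : ℤ), 0, 0) 1)
  rw [ofNormalForm_single] at h
  simpa [normalForm, monomial] using h

@[simp] theorem normalForm_ofNormalForm (m : Mono) : normalForm q (ofNormalForm q m) = m := by
  induction m using Finsupp.induction_linear with
  | zero => simp
  | add m n hm hn => simp only [map_add, hm, hn]
  | single y r => simp [ofNormalForm_single, normalForm_monomial]

/-- The monomials span the algebra, as an induction principle. -/
theorem induction_monomial {P : SUq q → Prop} (h0 : P 0) (ha : ∀ x y, P x → P y → P (x + y))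
    (hm : ∀ (r : ℂ) x, P (r • monomial q x)) (f : SUq q) : P f := by
  rw [← ofNormalForm_normalForm f]
  induction normalForm q f using Finsupp.induction_linear with
  | zero => simpa using h0
  | add m n hm hn => simpa using ha _ _ hm hn
  | single y r => simpa [ofNormalForm_single] using hm r y

/-! ### The operator `D₊` in the monomial basis -/

theorem twist_pow_b_mul_pow_c (j k : ℕ) : twist q (gen q Gen.b ^ j * gen q Gen.c ^ k) =
    (qc q ^ j * (qc q ^ k)⁻¹) • (gen q Gen.b ^ j * gen q Gen.c ^ k) := by
  simp [twist_gen, deg, pick, smul_pow, smul_smul, mul_comm]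

theorem Dplus_pow_b_mul (j : ℕ) (x : SUq q) :
    Dplus q (gen q Gen.b ^ j * x) = gen q Gen.b ^ j * Dplus q x := by
  induction j with
  | zero => simp
  | succ j ih => rw [pow_succ', mul_assoc, Dplus_mul, ih, Dplus_b, zero_mul, add_zero, mul_assoc]

theorem Dplus_pow_d_mul (j : ℕ) (x : SUq q) :
    Dplus q (gen q Gen.d ^ j * x) = gen q Gen.d ^ j * Dplus q x := by
  induction j with
  | zero => simp
  | succ j ih => rw [pow_succ', mul_assoc, Dplus_mul, ih, Dplus_d, zero_mul, add_zero, mul_assoc]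

/-- The truncated exponent `k - 1` is harmless at `k = 0`, where the factor `[0]` vanishes. The same
convention is used in `opPlus`. -/
theorem Dplus_pow_c (k : ℕ) : Dplus q (gen q Gen.c ^ k) =
    ((qc q)⁻¹ * qInt q k) • (gen q Gen.d * gen q Gen.c ^ (k - 1)) := by
  have hq := qc_ne q
  induction k with
  | zero => simpa [qInt_zero] using Dplus_algebraMap (q := q) 1
  | succ k ih =>
    have e : gen q Gen.c * ((qInt q k) • (gen q Gen.d * gen q Gen.c ^ (k - 1))) =
        (qc q * qInt q k) • (gen q Gen.d * gen q Gen.c ^ k) := by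
      cases k with
      | zero => simp [qInt_zero]
      | succ k =>
        rw [mul_smul_comm, ← mul_assoc, (gen_isTuple q).cd, smul_mul_assoc, smul_smul, mul_assoc,
          Nat.add_sub_cancel, ← pow_succ', mul_comm (qc q)]
    rw [pow_succ', Dplus_mul, ih, mul_smul, mul_smul_comm, e, Dplus_c, map_pow, twist_gen,
      qInt_add, qInt_one]
    simp only [deg, pick, Nat.add_sub_cancel, smul_pow, smul_mul_assoc, mul_smul_comm, zpow_neg,
      zpow_one]
    module

theorem Dplus_pow_a (n : ℕ) : Dplus q (gen q Gen.a ^ (n + 1)) =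
    ((qc q ^ (n + 1))⁻¹ * qInt q (n + 1)) • (gen q Gen.a ^ n * gen q Gen.b) := by
  have hq := qc_ne q
  induction n with
  | zero => simp [Dplus_a, qInt_one]
  | succ n ih =>
    have e : qInt q (n + 1 + 1) = qc q ^ (n + 1) + (qc q)⁻¹ * qInt q (n + 1) := by
      rw [add_comm, qInt_add, qInt_one, mul_one, pow_one]
    rw [pow_succ, Dplus_mul, ih, Dplus_a, twist_gen, e]
    simp only [deg, pick, smul_mul_assoc, mul_smul_comm, mul_assoc, ba, zpow_neg, zpow_one]
    rw [← mul_assoc _ (gen q Gen.a), ← pow_succ]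
    match_scalars
    field_simp
    ring

/-- The operator `D₊` in the monomial basis. -/
def opPlus (q : ℝˣ) : Module.End ℂ Mono :=
  Finsupp.linearCombination ℂ fun x : ℤ × ℕ × ℕ =>
    (Finsupp.single (x.1 - 1, x.2.1, x.2.2 - 1) (qc q ^ ((x.2.1 : ℤ) - 1) * qInt q x.2.2) : Mono) +
      if 0 < x.1 then Finsupp.single (x.1 - 1, x.2.1 + 1, x.2.2)
        (qc q ^ ((x.2.1 : ℤ) - x.1) * qInt q (x.2.2 + x.1.toNat)) else 0

theorem opPlus_single (n : ℤ) (j k : ℕ) (r : ℂ) : opPlus q (Finsupp.single (n, j, k) r) =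
    Finsupp.single (n - 1, j, k - 1) (r * (qc q ^ ((j : ℤ) - 1) * qInt q k)) +
      Finsupp.single (n - 1, j + 1, k)
        (if 0 < n then r * (qc q ^ ((j : ℤ) - n) * qInt q (k + n.toNat)) else 0) := by
  simp only [opPlus, Finsupp.linearCombination_single]
  split_ifs <;> simp [-Finsupp.single_mul]

theorem Dplus_pow_b_mul_pow_c (j k : ℕ) : Dplus q (gen q Gen.b ^ j * gen q Gen.c ^ k) =
    (qc q ^ ((j : ℤ) - 1) * qInt q k) •
      (gen q Gen.d * (gen q Gen.b ^ j * gen q Gen.c ^ (k - 1))) := by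
  have hq := qc_ne q
  rw [Dplus_pow_b_mul, Dplus_pow_c, mul_smul_comm, ← mul_assoc, pow_mul_of_comm (gen_isTuple q).bd,
    smul_mul_assoc, smul_smul, mul_assoc, zpow_sub_one₀ hq, zpow_natCast,
    mul_assoc (gen q Gen.d)]
  congr 1
  ring

/-- For `n > 0`, the Leibniz rule leaves a term `aⁿ d bʲ cᵏ⁻¹`, which splits by `a d = 1 + q b c`.
Its `b c` part is a multiple of the same monomial as the term from `D₊(aⁿ)`, and `qInt_add` combines
the coefficients into `[k + n]`. For `n ≤ 0` the only contribution is from `cᵏ`. -/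
theorem Dplus_monomial (x : ℤ × ℕ × ℕ) :
    Dplus q (monomial q x) = ofNormalForm q (opPlus q (Finsupp.single x 1)) := by
  have hq := qc_ne q
  obtain ⟨n, j, k⟩ := x
  simp only [opPlus_single, map_add, ofNormalForm_single, one_mul]
  obtain ⟨i, rfl | rfl⟩ := n.eq_nat_or_neg
  · cases i with
    | zero =>
      have e : ((0 : ℕ) : ℤ) - 1 = -((1 : ℕ) : ℤ) := by simp
      rw [e, monomial_nat, monomial_neg]
      simp [Dplus_pow_b_mul_pow_c, mul_assoc]
    | succ i =>
      have h : (0 < ((i + 1 : ℕ) : ℤ)) := by omega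
      have e : ((i + 1 : ℕ) : ℤ) - 1 = (i : ℤ) := by push_cast; ring
      have e1 : gen q Gen.a ^ (i + 1) * (gen q Gen.d * (gen q Gen.b ^ j * gen q Gen.c ^ (k - 1))) =
          gen q Gen.a ^ i * (gen q Gen.b ^ j * gen q Gen.c ^ (k - 1)) +
          qc q • (gen q Gen.a ^ i * (gen q Gen.b ^ (j + 1) * gen q Gen.c ^ (k - 1 + 1))) := by
        rw [pow_succ, mul_assoc, ← mul_assoc (gen q Gen.a), ad, add_mul, one_mul, mul_add,
          smul_mul_assoc, mul_smul_comm, mul_assoc (gen q Gen.b), b_mul_c_mul_pow]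
      -- `k - 1 + 1` differs from `k` only at `k = 0`, where `[k] = 0`.
      have e2 : qInt q k • (gen q Gen.a ^ i * (gen q Gen.b ^ (j + 1) * gen q Gen.c ^ (k - 1 + 1))) =
          qInt q k • (gen q Gen.a ^ i * (gen q Gen.b ^ (j + 1) * gen q Gen.c ^ k)) := by
        cases k <;> simp [qInt_zero]
      simp only [e, h, if_true, monomial_nat, Int.toNat_natCast]
      rw [mul_assoc, Dplus_mul, Dplus_pow_b_mul_pow_c, Dplus_pow_a, twist_pow_b_mul_pow_c,
        mul_smul_comm, e1, smul_mul_smul_comm, mul_assoc (_ ^ i), ← mul_assoc (gen q Gen.b),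
        ← pow_succ', smul_add, smul_smul, mul_right_comm _ _ (qc q), mul_smul (_ * qc q), e2,
        qInt_add q k, add_assoc, mul_assoc (_ ^ i), mul_assoc (_ ^ i), ← mul_smul, ← add_smul,
        zpow_sub₀ hq, zpow_sub₀ hq]
      congr 2
      simp only [zpow_natCast, zpow_one]
      field_simp
  · have h : ¬ (0 < -(i : ℤ)) := by omega
    have e : -(i : ℤ) - 1 = -((i + 1 : ℕ) : ℤ) := by push_cast; ring
    simp only [h, if_false, zero_smul, add_zero, e, monomial_neg]
    rw [mul_assoc, Dplus_pow_d_mul, Dplus_pow_b_mul_pow_c, mul_smul_comm, pow_succ]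
    simp only [mul_assoc]

theorem Dplus_ofNormalForm (m : Mono) :
    Dplus q (ofNormalForm q m) = ofNormalForm q (opPlus q m) := by
  induction m using Finsupp.induction_linear with
  | zero => simp
  | add m n hm hn => simp only [map_add, hm, hn]
  | single y r =>
    have e : (Finsupp.single y r : Mono) = r • Finsupp.single y 1 := by simp
    rw [e, map_smul, map_smul, map_smul, map_smul, ofNormalForm_single, one_smul, Dplus_monomial]

/-! ### Invariance properties of the Haar functional -/

theorem haar_Dplus (f : SUq q) : haar q (Dplus q f) = 0 := by
  have hq := qc_ne q
  induction f using induction_monomial with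
  | h0 => simp
  | ha x y hx hy => rw [map_add, map_add, hx, hy, add_zero]
  | hm r x =>
    obtain ⟨n, j, k⟩ := x
    rw [map_smul, map_smul, Dplus_monomial, opPlus_single, map_add, ofNormalForm_single,
      ofNormalForm_single, map_add, map_smul, map_smul, haar_monomial, haar_monomial]
    -- Nonzero Haar values need `n = 1` and `k = j + 1`. The two terms then contribute `(-1)ʲ` and
    -- `(-1)ʲ⁺¹`, with the common factor `qʲ⁻¹`, since each `q`-integer coefficient cancels the
    -- denominator of the Haar value.
    by_cases hn : n = 1
    · subst hn
      rcases k with _ | k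
      · simp [qInt_zero]
      · by_cases hj : j = k
        · subst hj
          have := qInt_succ_ne_zero q j
          have := qInt_succ_ne_zero q (j + 1)
          simp [pow_succ]
          right
          field_simp
          ring
        · simp [hj]
    · have : n - 1 ≠ 0 := by omega
      simp [this]

/-- The scalar matters only on the monomials `bʲ cʲ`, where `h` is supported and the factors from
`b*` and `c*` cancel. -/
theorem star_monomial (q : ℝˣ) (n : ℤ) (j k : ℕ) : ∃ s : ℂ, star (monomial q (n, j, k)) =
    s • monomial q (-n, k, j) ∧ (n = 0 → j = k → s = 1) := by
  have hq := qc_ne q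
  obtain ⟨i, rfl | rfl⟩ := n.eq_nat_or_neg
  · refine ⟨(-(qc q)⁻¹) ^ k * (-qc q) ^ j * (qc q ^ i) ^ j * (qc q ^ i) ^ k, ?_, ?_⟩
    · rw [monomial_nat, monomial_neg, star_mul, star_mul, star_pow, star_pow, star_pow, star_a,
        star_b, star_c, smul_pow, smul_pow, mul_comm ((-(qc q)⁻¹) ^ k)]
      simp only [smul_mul_assoc, mul_smul_comm]
      rw [pow_mul_pow_of_comm (gen_isTuple q).cd, mul_smul_comm, ← mul_assoc,
        pow_mul_pow_of_comm (gen_isTuple q).bd]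
      simp only [smul_mul_assoc, smul_smul, mul_assoc]
    · intro hi hj
      obtain rfl : i = 0 := by simpa using hi
      subst hj
      simp [← mul_pow, hq]
  · refine ⟨(-(qc q)⁻¹) ^ k * (-qc q) ^ j * ((qc q)⁻¹ ^ i) ^ j * ((qc q)⁻¹ ^ i) ^ k, ?_, ?_⟩
    · rw [monomial_neg, neg_neg, monomial_nat, star_mul, star_mul, star_pow, star_pow, star_pow,
        star_d, star_b, star_c, smul_pow, smul_pow, mul_comm ((-(qc q)⁻¹) ^ k)]
      simp only [smul_mul_assoc, mul_smul_comm]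
      rw [pow_mul_pow_of_comm ca, mul_smul_comm, ← mul_assoc, pow_mul_pow_of_comm ba]
      simp only [smul_mul_assoc, smul_smul, mul_assoc]
    · intro hi hj
      obtain rfl : i = 0 := by simpa using hi
      subst hj
      simp [← mul_pow, hq]

theorem haar_star (f : SUq q) : haar q (star f) = conj (haar q f) := by
  induction f using induction_monomial with
  | h0 => simp
  | ha x y hx hy => rw [star_add, map_add, map_add, map_add, hx, hy]
  | hm r x =>
    obtain ⟨n, j, k⟩ := x
    obtain ⟨s, hs, hs1⟩ := star_monomial q n j k
    rw [star_smul, map_smul, map_smul, smul_eq_mul, smul_eq_mul, map_mul, hs, map_smul,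
      haar_monomial, haar_monomial]
    by_cases h : n = 0 ∧ j = k
    · obtain ⟨rfl, rfl⟩ := h
      simp [hs1 rfl rfl, conj_qInt]
    · have h' : ¬ (-n = 0 ∧ k = j) := fun h' => h ⟨by omega, by omega⟩
      simp only [h, h', if_false, smul_zero, map_zero, mul_zero]

/-! ### The involution exchanges the two derivations; integration by parts -/

theorem Dplus_star {k : ℤ} {f : SUq q} (hf : f ∈ E q k) :
    Dplus q (star f) = (Complex.I * (qc q ^ k)⁻¹) • star (Dminus q f) :=
  (good_of_mem hf).2.2.2.2.2.1

theorem star_Dminus {k : ℤ} {f : SUq q} (hf : f ∈ E q k) :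
    star (Dminus q f) = (-Complex.I * qc q ^ k) • Dplus q (star f) := by
  have h : -Complex.I * qc q ^ k * (Complex.I * (qc q ^ k)⁻¹) = 1 := by
    have := zpow_ne_zero k (qc_ne q)
    field_simp
    simp
  rw [Dplus_star hf, smul_smul, h, one_smul]

theorem star_Dplus {k : ℤ} {f : SUq q} (hf : f ∈ E q k) :
    star (Dplus q f) = (-Complex.I * qc q ^ k) • Dminus q (star f) := by
  have h := star_Dminus (star_mem_E hf rfl)
  have h2 : star Complex.I = -Complex.I := Complex.conj_I
  rw [star_star] at h
  have e : -Complex.I * qc q ^ k * (Complex.I * qc q ^ (-k)) = 1 := by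
    have := zpow_ne_zero k (qc_ne q)
    rw [zpow_neg]
    field_simp
    simp
  have h3 := congrArg star h
  rw [star_star, star_smul, star_mul', star_neg, h2, neg_neg, conj_qc_zpow] at h3
  rw [h3, smul_smul, e, one_smul]

/-- On homogeneous elements, conjugation by the involution turns `D₋` into a multiple of `D₊`, and
`h` is hermitian, so `haar_Dplus` applies. Homogeneous elements span. -/
theorem haar_Dminus (f : SUq q) : haar q (Dminus q f) = 0 := by
  have h : ∀ k, ∀ f ∈ good q k, haar q (Dminus q f) = 0 := by
    intro k f hf
    rw [← star_star (Dminus q f), haar_star, star_Dminus hf.1, map_smul, haar_Dplus, smul_zero,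
      map_zero]
  have hf := iSup_good q f
  induction hf using Submodule.iSup_induction' with
  | mem k x hx => exact h k x hx
  | zero => simp
  | add x y _ _ hx hy => rw [map_add, map_add, hx, hy, add_zero]

/-- Integration by parts: apply `h ∘ D₊ = 0` to the product `x g`. -/
theorem haar_mul_Dplus {k : ℤ} (x : SUq q) {g : SUq q} (hg : g ∈ E q k) :
    haar q (x * Dplus q g) = -(qc q ^ k * haar q (Dplus q x * g)) := by
  have h := haar_Dplus (x * g)
  rw [Dplus_mul, (good_of_mem hg).2.2.1, mul_smul_comm, map_add, map_smul, smul_eq_mul] at h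
  exact eq_neg_of_add_eq_zero_left h

theorem haar_mul_Dminus {k : ℤ} (x : SUq q) {g : SUq q} (hg : g ∈ E q k) :
    haar q (x * Dminus q g) = -(qc q ^ k * haar q (Dminus q x * g)) := by
  have h := haar_Dminus (x * g)
  rw [Dminus_mul, (good_of_mem hg).2.2.1, mul_smul_comm, map_add, map_smul, smul_eq_mul] at h
  exact eq_neg_of_add_eq_zero_left h

/-! ### Existence of the adjoints -/

theorem innerProd_eq (ω ν : Forms q) : innerProd ω ν =
    haar q ((ω.1 : SUq q) * star (ν.1 : SUq q)) +
    haar q ((ω.2.1 : SUq q) * star (ν.2.1 : SUq q)) +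
    qc q ^ 2 * haar q ((ω.2.2.1 : SUq q) * star (ν.2.2.1 : SUq q)) +
    haar q ((ω.2.2.2 : SUq q) * star (ν.2.2.2 : SUq q)) := by
  simp [innerProd, integral, topForm, metric, mulE, starE]

theorem innerProd_add_left (ω ω' ν : Forms q) :
    innerProd (ω + ω') ν = innerProd ω ν + innerProd ω' ν := by
  simp [innerProd_eq, add_mul]
  ring

theorem innerProd_add_right (ω ν ν' : Forms q) :
    innerProd ω (ν + ν') = innerProd ω ν + innerProd ω ν' := by
  simp [innerProd_eq, mul_add]
  ring

/-- Two integrations by parts, one for functions against `(1, 0)`-forms and one for `(0, 1)`-forms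
against `2`-forms. In the first, the factor `q²` of `star_Dminus` cancels the `q⁻²` from the degree
of `f*`. In the second, the weight `q²` of `e⁻` matches the `q²` in `∂(g e⁻)`. -/
theorem isAdjoint_del (q : ℝˣ) : IsAdjoint (del q) (-(hodge q ∘ₗ delbar q ∘ₗ hodge q)) := by
  intro ω ν
  have hI : star Complex.I = -Complex.I := Complex.conj_I
  have h1 := haar_mul_Dplus (ω.1 : SUq q) (star_mem_E (l := -2) ν.2.1.2 rfl)
  have h2 := haar_mul_Dplus (ω.2.2.1 : SUq q) (star_mem_E (l := 0) ν.2.2.2.2 rfl)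
  simp [innerProd_eq, del, delbar, hodge, Dp, Dm, star_Dminus ν.2.1.2, star_Dminus ν.2.2.2.2, h1,
    h2, hI, smul_smul]
  have hq := qc_ne q
  field_simp
  simp

theorem isAdjoint_delbar (q : ℝˣ) : IsAdjoint (delbar q) (-(hodge q ∘ₗ del q ∘ₗ hodge q)) := by
  intro ω ν
  have hI : star Complex.I = -Complex.I := Complex.conj_I
  have h1 := haar_mul_Dminus (ω.1 : SUq q) (star_mem_E (l := 2) ν.2.2.1.2 rfl)
  have h2 := haar_mul_Dminus (ω.2.1 : SUq q) (star_mem_E (l := 0) ν.2.2.2.2 rfl)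
  simp [innerProd_eq, del, delbar, hodge, Dp, Dm, star_Dplus ν.2.2.1.2, star_Dplus ν.2.2.2.2, h1,
    h2, hI, smul_smul]
  have hq := qc_ne q
  rw [conj_qc]
  field_simp
  simp

theorem IsAdjoint.add {T T' S S' : Forms q →ₗ[ℂ] Forms q} (h : IsAdjoint T S)
    (h' : IsAdjoint T' S') : IsAdjoint (T + T') (S + S') := fun ω ν => by
  rw [LinearMap.add_apply, LinearMap.add_apply, innerProd_add_left, innerProd_add_right, h, h']

theorem isAdjoint_extd (q : ℝˣ) : IsAdjoint (extd q) (-(hodge q ∘ₗ extd q ∘ₗ hodge q)) := by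
  have e : -(hodge q ∘ₗ extd q ∘ₗ hodge q) = -(hodge q ∘ₗ delbar q ∘ₗ hodge q) +
      -(hodge q ∘ₗ del q ∘ₗ hodge q) := by
    rw [extd, LinearMap.add_comp, LinearMap.comp_add]
    exact LinearMap.ext fun ω => by simp only [LinearMap.neg_apply, LinearMap.add_apply]; abel
  rw [e]
  exact (isAdjoint_del q).add (isAdjoint_delbar q)

/-! ### The kernel of `D₊` -/

theorem opPlus_apply_of_neg (m : Mono) {n : ℤ} (hn : n ≤ 0) (j k : ℕ) :
    opPlus q m (n - 1, j, k) = qc q ^ ((j : ℤ) - 1) * qInt q (k + 1) * m (n, j, k + 1) := by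
  induction m using Finsupp.induction_linear with
  | zero => simp
  | add x y hx hy => simp only [map_add, Finsupp.add_apply, hx, hy, mul_add]
  | single x r =>
    obtain ⟨n', j', k'⟩ := x
    rw [opPlus_single, Finsupp.add_apply, Finsupp.single_apply, Finsupp.single_apply,
      Finsupp.single_apply]
    simp only [Prod.mk.injEq, sub_left_inj]
    by_cases h : n' = n
    · subst h
      -- When `k' = 0`, truncated subtraction may land on the index in question, but the coefficient
      -- is `[0] = 0`.
      rcases k' with _ | k'
      · simp [qInt_zero, hn]
      · by_cases h2 : j' = j ∧ k' = k
        · obtain ⟨rfl, rfl⟩ := h2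
          simp [mul_comm]
        · simp [h2, hn]
    · simp [h]

theorem opPlus_apply_succ_of_pos (m : Mono) {n : ℤ} (hn : 0 < n) (j k : ℕ) :
    opPlus q m (n - 1, j + 1, k) =
      qc q ^ (j : ℤ) * qInt q (k + 1) * m (n, j + 1, k + 1) +
        qc q ^ ((j : ℤ) - n) * qInt q (k + n.toNat) * m (n, j, k) := by
  induction m using Finsupp.induction_linear with
  | zero => simp
  | add x y hx hy => simp only [map_add, Finsupp.add_apply, hx, hy, mul_add]; ring
  | single x r =>
    obtain ⟨n', j', k'⟩ := x
    rw [opPlus_single, Finsupp.add_apply, Finsupp.single_apply, Finsupp.single_apply,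
      Finsupp.single_apply, Finsupp.single_apply]
    simp only [Prod.mk.injEq, sub_left_inj, add_left_inj]
    by_cases h : n' = n
    · subst h
      simp only [true_and, hn, if_true]
      congr 1
      · rcases k' with _ | k'
        · simp [qInt_zero]
        · by_cases h2 : j' = j + 1 ∧ k' = k
          · obtain ⟨rfl, rfl⟩ := h2
            simp [mul_comm]
          · simp [h2]
      · by_cases h2 : j' = j ∧ k' = k
        · obtain ⟨rfl, rfl⟩ := h2
          simp [mul_comm]
        · simp [h2]
    · simp [h]

/-- For `n ≤ 0` each output coefficient is a nonzero multiple of a single input coefficient. For `n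
> 0` it links neighbours on the diagonal `(n, j + s, k + s)`. Finite support provides a zero far out
on that diagonal, and the recursion carries it back. -/
theorem apply_eq_zero_of_opPlus {m : Mono} (h : opPlus q m = 0) {n : ℤ} {j k : ℕ}
    (hm : 0 < n ∨ 0 < k) : m (n, j, k) = 0 := by
  have hq := qc_ne q
  rcases lt_or_ge 0 n with hn | hn
  · have key : ∀ s j k, m (n, j + s, k + s) = 0 → m (n, j, k) = 0 := by
      intro s
      induction s with
      | zero => exact fun j k h => h
      | succ s ih =>
        intro j k hs
        have h1 : m (n, j + 1, k + 1) = 0 := by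
          apply ih
          rwa [add_right_comm, add_assoc, add_right_comm k, add_assoc k]
        have h2 := opPlus_apply_succ_of_pos (q := q) m hn j k
        obtain ⟨i, hi⟩ : ∃ i, k + n.toNat = i + 1 := ⟨k + n.toNat - 1, by omega⟩
        rw [h, Finsupp.zero_apply, h1, mul_zero, zero_add, hi] at h2
        have h3 := zpow_ne_zero ((j : ℤ) - n) hq
        simpa [h3, qInt_succ_ne_zero] using h2.symm
    -- Otherwise the support of `m` would contain an infinite diagonal.
    obtain ⟨s, hs⟩ : ∃ s, m (n, j + s, k + s) = 0 := by
      by_contra! hc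
      have hinj : Function.Injective fun s : ℕ => (n, j + s, k + s) := fun s t h => by
        simpa using h
      exact (Set.infinite_range_of_injective hinj).mono
        (by rintro _ ⟨s, rfl⟩; simpa using hc s) m.hasFiniteSupport
    exact key s j k hs
  · obtain ⟨i, rfl⟩ : ∃ i, k = i + 1 := ⟨k - 1, by omega⟩
    have h2 := opPlus_apply_of_neg (q := q) m hn j i
    have h3 := zpow_ne_zero ((j : ℤ) - 1) hq
    rw [h, Finsupp.zero_apply] at h2
    simpa [h3, qInt_succ_ne_zero] using h2.symm

/-! ### Degrees of monomials and homogeneous elements of the kernel -/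

theorem pow_mem_E {k : ℤ} {f : SUq q} (hf : f ∈ E q k) (n : ℕ) : f ^ n ∈ E q (n * k) := by
  induction n with
  | zero => simpa using algebraMap_mem_E q 1
  | succ n ih => exact pow_succ f n ▸ mul_mem_E ih hf (by push_cast; ring)

theorem monomial_mem_E (q : ℝˣ) (n : ℤ) (j k : ℕ) :
    monomial q (n, j, k) ∈ E q (-n + j - k) := by
  have ha := pow_mem_E (gen_mem_E q Gen.a) n.toNat
  have hd := pow_mem_E (gen_mem_E q Gen.d) (-n).toNat
  have hb := pow_mem_E (gen_mem_E q Gen.b) j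
  have hc := pow_mem_E (gen_mem_E q Gen.c) k
  simp only [deg, pick] at ha hb hc hd
  exact mul_mem_E (mul_mem_E (mul_mem_E ha hd rfl) hb rfl) hc (by omega)

theorem component_monomial (q : ℝˣ) (l n : ℤ) (j k : ℕ) : component q l (monomial q (n, j, k)) =
    if -n + j - k = l then monomial q (n, j, k) else 0 :=
  component_of_mem (monomial_mem_E q n j k)

theorem haar_component_zero (f : SUq q) : haar q (component q 0 f) = haar q f := by
  induction f using induction_monomial with
  | h0 => simp
  | ha x y hx hy => rw [map_add, map_add, map_add, hx, hy]
  | hm r x =>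
    obtain ⟨n, j, k⟩ := x
    rw [map_smul, map_smul, map_smul, component_monomial]
    split_ifs with h
    · rfl
    · rw [haar_monomial, if_neg, map_zero]
      rintro ⟨h1, h2⟩
      simp only at h1 h2
      omega

theorem haar_of_mem {k : ℤ} {f : SUq q} (hf : f ∈ E q k) (hk : k ≠ 0) : haar q f = 0 := by
  rw [← haar_component_zero, component_of_mem hf, if_neg hk, map_zero]

/-- An element of degree `k ≤ 0` in the kernel of `D₊` is a scalar. -/
theorem eq_smul_one_of_Dplus_eq_zero {k : ℤ} {f : SUq q} (hf : f ∈ E q k) (hk : k ≤ 0)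
    (h : Dplus q f = 0) : ∃ r : ℂ, f = r • 1 ∧ (k < 0 → r = 0) := by
  have h0 : opPlus q (normalForm q f) = 0 := by
    rw [← normalForm_ofNormalForm (q := q) (opPlus q _), ← Dplus_ofNormalForm,
      ofNormalForm_normalForm, h, map_zero]
  have e : f = component q k (ofNormalForm q (normalForm q f)) := by
    rw [ofNormalForm_normalForm, component_of_mem hf, if_pos rfl]
  refine ⟨if k = 0 then normalForm q f (0, 0, 0) else 0, ?_, fun hk' => if_neg hk'.ne⟩
  conv_lhs => rw [e, ofNormalForm, Finsupp.linearCombination_apply, Finsupp.sum, map_sum]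
  rw [Finset.sum_eq_single (0, 0, 0)]
  · rw [map_smul, component_monomial]
    have h1 : -(0 : ℤ) + ((0 : ℕ) : ℤ) - ((0 : ℕ) : ℤ) = k ↔ k = 0 := by simp [eq_comm]
    simp only [h1]
    split_ifs
    · simp [monomial]
    · simp
  -- A surviving monomial has `n ≤ 0` and `l = 0`, hence degree `-n + j ≥ 0`. Degree `k ≤ 0` then
  -- forces `n = j = 0`.
  · rintro ⟨n, j, l⟩ hm hne
    have hnl : ¬ (0 < n ∨ 0 < l) := fun hnl =>
      Finsupp.mem_support_iff.1 hm (apply_eq_zero_of_opPlus h0 hnl)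
    rw [map_smul, component_monomial, if_neg, smul_zero]
    intro hw
    apply hne
    simp only [Prod.mk.injEq]
    omega
  · intro hm
    rw [Finsupp.notMem_support_iff.1 hm, zero_smul, map_zero]

/-! ### `D₊` is locally nilpotent -/

theorem Dplus_pow_twist {n : ℕ} {f : SUq q} (hf : (Dplus q ^ n) f = 0) :
    (Dplus q ^ n) (twist q f) = 0 := by
  have h : ∀ (n : ℕ) (f : SUq q), (Dplus q ^ n) (twist q f) =
      ((qc q ^ 2)⁻¹) ^ n • twist q ((Dplus q ^ n) f) := by
    intro n
    induction n with
    | zero => simp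
    | succ n ih =>
      intro f
      have e : Dplus q (twist q f) = (qc q ^ 2)⁻¹ • twist q (Dplus q f) := by
        rw [twist_twist_comm_plus, inv_smul_smul₀ (pow_ne_zero 2 (qc_ne q))]
      rw [pow_succ (Dplus q), Module.End.mul_apply, e, map_smul, ih, smul_smul, ← pow_succ',
        Module.End.mul_apply]
  rw [h, hf, map_zero, smul_zero]

/-- Each application of the Leibniz rule lowers the nilpotency order of one factor by one. The twist
on the second factor does no harm, since it commutes with `D₊` up to a scalar (`Dplus_pow_twist`).
-/
theorem Dplus_pow_mul (s : ℕ) : ∀ {m n : ℕ} {f g : SUq q}, m + n ≤ s + 1 →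
    (Dplus q ^ m) f = 0 → (Dplus q ^ n) g = 0 → (Dplus q ^ s) (f * g) = 0 := by
  induction s with
  | zero =>
    intro m n f g hmn hf hg
    obtain rfl | rfl : m = 0 ∨ n = 0 := by omega
    · simp_all
    · simp_all
  | succ s ih =>
    intro m n f g hmn hf hg
    rcases m with _ | m
    · simp_all
    rcases n with _ | n
    · simp_all
    rw [pow_succ, Module.End.mul_apply, Dplus_mul, map_add]
    rw [ih (m := m + 1) (n := n) (by omega) hf (by rwa [pow_succ] at hg),
      ih (m := m) (n := n + 1) (by omega) (by rwa [pow_succ] at hf) (Dplus_pow_twist hg), add_zero]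

theorem exists_Dplus_pow_eq_zero (f : SUq q) : ∃ n, (Dplus q ^ n) f = 0 := by
  induction f using SUq.induction with
  | hs r => exact ⟨1, by simp [Dplus_algebraMap]⟩
  | hg x =>
    refine ⟨2, ?_⟩
    rw [pow_two, Module.End.mul_apply]
    cases x <;> simp [Dplus_a, Dplus_b, Dplus_c, Dplus_d]
  | hm x y hx hy =>
    obtain ⟨m, hm⟩ := hx
    obtain ⟨n, hn⟩ := hy
    exact ⟨m + n, Dplus_pow_mul _ (by omega) hm hn⟩
  | ha x y hx hy =>
    obtain ⟨m, hm⟩ := hx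
    obtain ⟨n, hn⟩ := hy
    refine ⟨m + n, ?_⟩
    have h1 : (Dplus q ^ (m + n)) x = 0 := by
      rw [add_comm, pow_add, Module.End.mul_apply, hm, map_zero]
    have h2 : (Dplus q ^ (m + n)) y = 0 := by
      rw [pow_add, Module.End.mul_apply, hn, map_zero]
    rw [map_add, h1, h2, add_zero]

/-! ### Nondegeneracy of the Haar functional -/

/-- The left ideal of all `g` with `h(f g) = 0` for all `f`. -/
def haarKer (q : ℝˣ) : Submodule ℂ (SUq q) where
  carrier := {g | ∀ f, haar q (f * g) = 0}
  zero_mem' := by simp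
  add_mem' hx hy f := by rw [mul_add, map_add, hx, hy, add_zero]
  smul_mem' r x hx f := by rw [mul_smul_comm, map_smul, hx, smul_zero]

theorem mul_mem_haarKer (f : SUq q) {g : SUq q} (hg : g ∈ haarKer q) : f * g ∈ haarKer q :=
  fun x => by rw [← mul_assoc]; exact hg _

theorem Dplus_mem_haarKer {k : ℤ} {g : SUq q} (hk : g ∈ E q k) (hg : g ∈ haarKer q) :
    Dplus q g ∈ haarKer q := fun x => by rw [haar_mul_Dplus x hk, hg, mul_zero, neg_zero]

theorem Dminus_mem_haarKer {k : ℤ} {g : SUq q} (hk : g ∈ E q k) (hg : g ∈ haarKer q) :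
    Dminus q g ∈ haarKer q := fun x => by rw [haar_mul_Dminus x hk, hg, mul_zero, neg_zero]

/-- By `weight_zpow_add`, the structure constants of positive degree satisfy `w₁ = i q²` and `wₖ₊₁ =
i q² + q² wₖ`. They therefore stay in `i` times the positive reals. -/
theorem weight_zpow_ne_zero (q : ℝˣ) (k : ℕ) : (weight q ^ ((k : ℤ) + 1)) 0 1 ≠ 0 := by
  have hq : (q : ℝ) ≠ 0 := q.ne_zero
  have h1 : (weight q ^ (1 : ℤ)) 0 1 = Complex.I * qc q ^ 2 := by simp [weight]
  obtain ⟨s, hs, h⟩ : ∃ s : ℝ, 0 < s ∧ (weight q ^ ((k : ℤ) + 1)) 0 1 = Complex.I * (s : ℂ) := by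
    induction k with
    | zero => exact ⟨(q : ℝ) ^ 2, by positivity, by simp [weight, qc]⟩
    | succ k ih =>
      obtain ⟨s, hs, h⟩ := ih
      refine ⟨(q : ℝ) ^ 2 * (1 + s), by positivity, ?_⟩
      rw [weight_zpow_add, h1, Nat.cast_succ, h]
      simp [qc]
      ring
  rw [h]
  exact mul_ne_zero Complex.I_ne_zero (Complex.ofReal_ne_zero.2 hs.ne')

/-- Induction on the degree of a highest weight vector `g`: suitable combinations of `a g` with `b
D₋ g`, and of `c g` with `d D₋ g`, are highest weight vectors of degree one less in the same left
ideal. -/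
theorem eq_zero_of_mem_haarKer_of_Dplus (k : ℕ) : ∀ {g : SUq q}, g ∈ E q k → g ∈ haarKer q →
    Dplus q g = 0 → g = 0 := by
  have hq := qc_ne q
  induction k with
  | zero =>
    intro g hE hN hD
    obtain ⟨r, rfl, -⟩ := eq_smul_one_of_Dplus_eq_zero hE le_rfl hD
    have h1 := hN 1
    have h2 := haar_a q 0 0 0
    simp only [pow_zero, mul_one, if_true, and_self, zero_add, qInt_one, div_one] at h2
    rw [one_mul, map_smul, h2, smul_eq_mul, mul_one] at h1
    rw [h1, zero_smul]
  | succ k ih =>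
    intro g hE hN hD
    have hw := weight_zpow_ne_zero q k
    set w := (weight q ^ ((k : ℤ) + 1)) 0 1 with hw'
    -- The commutation relation `D₋ D₊ - q² D₊ D₋ = w` on this degree, with `D₊ g = 0`.
    have hDD : Dplus q (Dminus q g) = (-(qc q ^ 2)⁻¹ * w) • g := by
      have h := (good_of_mem hE).2.2.2.2.2.2
      rw [hD, map_zero, zero_sub, Nat.cast_succ, ← hw'] at h
      rw [mul_smul, ← h, smul_neg, neg_smul, neg_neg, inv_smul_smul₀ (pow_ne_zero 2 hq)]
    have htw : twist q g = qc q ^ ((k : ℤ) + 1) • g := by simpa using (good_of_mem hE).2.2.1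
    have hE' : Dminus q g ∈ E q ((k : ℤ) + 1 - 2) := by
      simpa using Dminus_mem_E hE rfl
    have hN' := Dminus_mem_haarKer hE hN
    -- the corrections of `a g` and `c g` that lie in the kernel of `D₊`
    set κ : ℂ := -(qc q ^ ((k : ℤ) + 2) * w⁻¹) with hκ
    -- This choice of `κ` balances `D₊(x g) = q⁻¹ qᵏ⁺¹ y g` against `D₊(y D₋ g) = -q⁻² w y g`, for
    -- `(x, y)` equal to `(a, b)` or `(c, d)`.
    have hκw : κ * (-(qc q ^ 2)⁻¹ * w) = (qc q)⁻¹ * qc q ^ ((k : ℤ) + 1) := by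
      rw [hκ, zpow_add₀ hq, zpow_add₀ hq]
      field_simp
    have hac : ∀ x y : SUq q, x ∈ E q (-1) → y ∈ E q 1 → Dplus q x = (qc q)⁻¹ • y →
        Dplus q y = 0 → x * g - κ • (y * Dminus q g) = 0 := by
      intro x y hx hy hxy hy0
      refine ih ?_ ?_ ?_
      · exact sub_mem (mul_mem_E hx hE (by push_cast; ring))
          (Submodule.smul_mem _ _ (mul_mem_E hy hE' (by ring)))
      · exact sub_mem (mul_mem_haarKer _ hN) (Submodule.smul_mem _ _ (mul_mem_haarKer _ hN'))
      · rw [map_sub, map_smul, Dplus_mul, Dplus_mul, hD, hDD, hxy, hy0, htw, mul_zero, zero_mul,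
          zero_add, add_zero, smul_mul_smul_comm, mul_smul_comm, smul_smul, hκw, sub_self]
    have hu := hac _ _ (gen_mem_E q Gen.a) (gen_mem_E q Gen.b) Dplus_a Dplus_b
    have hv := hac _ _ (gen_mem_E q Gen.c) (gen_mem_E q Gen.d) Dplus_c Dplus_d
    rw [sub_eq_zero] at hu hv
    -- Substituting `a g = κ b D₋ g` and `c g = κ d D₋ g` leaves `κ (d b - q⁻¹ b d) D₋ g`, which is
    -- zero.
    calc g = (gen q Gen.d * gen q Gen.a) * g -
          (qc q)⁻¹ • ((gen q Gen.b * gen q Gen.c) * g) := by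
          rw [da, add_mul, one_mul, smul_mul_assoc, add_sub_cancel_right]
      _ = 0 := by
          rw [mul_assoc, mul_assoc, hu, hv, mul_smul_comm, mul_smul_comm, ← mul_assoc,
            ← mul_assoc, db, smul_mul_assoc, smul_comm, sub_self]

/-- Induction on the nilpotency order of `D₊` at `g`: the ideal contains `D₊ g`, which has smaller
order, so `D₊ g = 0` and `g` is a highest weight vector. -/
theorem eq_zero_of_mem_haarKer {k : ℤ} {g : SUq q} (hE : g ∈ E q k) (hN : g ∈ haarKer q) :
    g = 0 := by
  obtain ⟨n, hn⟩ := exists_Dplus_pow_eq_zero g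
  induction n generalizing k g with
  | zero => simpa using hn
  | succ n ih =>
    rw [pow_succ, Module.End.mul_apply] at hn
    have hD := ih (Dplus_mem_E hE rfl) (Dplus_mem_haarKer hE hN) hn
    rcases lt_or_ge k 0 with hk | hk
    · obtain ⟨r, rfl, hr⟩ := eq_smul_one_of_Dplus_eq_zero hE hk.le hD
      rw [hr hk, zero_smul]
    · lift k to ℕ using hk
      exact eq_zero_of_mem_haarKer_of_Dplus k hE hN hD

/-- Testing only against degree `k` is enough: for `f` of any other degree, `f g*` has nonzero
degree and `h` vanishes on it. -/
theorem eq_zero_of_haar_mul_star {k : ℤ} {g : SUq q} (hg : g ∈ E q k)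
    (h : ∀ f ∈ E q k, haar q (f * star g) = 0) : g = 0 := by
  have hs : star g ∈ E q (-k) := star_mem_E hg rfl
  suffices star g ∈ haarKer q from star_eq_zero.1 (eq_zero_of_mem_haarKer hs this)
  intro f
  have hf := iSup_good q f
  induction hf using Submodule.iSup_induction' with
  | mem l x hx =>
    by_cases hl : l = k
    · exact h x (hl ▸ hx.1)
    · exact haar_of_mem (mul_mem_E hx.1 hs rfl) (by omega)
  | zero => simp
  | add x y _ _ hx hy => rw [add_mul, map_add, hx, hy, add_zero]

theorem eq_zero_of_innerProd {ν : Forms q} (h : ∀ ω, innerProd ω ν = 0) : ν = 0 := by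
  obtain ⟨m, f, g, t⟩ := ν
  have h1 : (m : SUq q) = 0 := eq_zero_of_haar_mul_star m.2 fun x hx => by
    simpa [innerProd_eq] using h (⟨x, hx⟩, 0, 0, 0)
  have h2 : (f : SUq q) = 0 := eq_zero_of_haar_mul_star f.2 fun x hx => by
    simpa [innerProd_eq] using h (0, ⟨x, hx⟩, 0, 0)
  have h3 : (g : SUq q) = 0 := eq_zero_of_haar_mul_star g.2 fun x hx => by
    simpa [innerProd_eq, qc_ne] using h (0, 0, ⟨x, hx⟩, 0)
  have h4 : (t : SUq q) = 0 := eq_zero_of_haar_mul_star t.2 fun x hx => by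
    simpa [innerProd_eq] using h (0, 0, 0, ⟨x, hx⟩)
  simp only [ZeroMemClass.coe_eq_zero] at h1 h2 h3 h4
  rw [h1, h2, h3, h4]
  rfl

theorem IsAdjoint.iff_eq {T S : Forms q →ₗ[ℂ] Forms q} (h : IsAdjoint T S)
    (S' : Forms q →ₗ[ℂ] Forms q) : IsAdjoint T S' ↔ S' = S := by
  refine ⟨fun h' => LinearMap.ext fun ν => sub_eq_zero.1 (eq_zero_of_innerProd fun ω => ?_),
    fun e => e ▸ h⟩
  -- Writing `S' ν = (S' ν - S ν) + S ν`, additivity shows that the difference is orthogonal to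
  -- every `ω`.
  have e := innerProd_add_right ω (S' ν - S ν) (S ν)
  rwa [sub_add_cancel, ← h, ← h', right_eq_add] at e

end Podles

end

theorem mainTheorem8 (q : ℝˣ) :
    (∀ S : Podles.Forms q →ₗ[ℂ] Podles.Forms q,
      Podles.IsAdjoint (Podles.extd q) S ↔
        S = -(Podles.hodge q ∘ₗ Podles.extd q ∘ₗ Podles.hodge q)) ∧
    (∀ S : Podles.Forms q →ₗ[ℂ] Podles.Forms q,
      Podles.IsAdjoint (Podles.del q) S ↔
        S = -(Podles.hodge q ∘ₗ Podles.delbar q ∘ₗ Podles.hodge q)) ∧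
    (∀ S : Podles.Forms q →ₗ[ℂ] Podles.Forms q,
      Podles.IsAdjoint (Podles.delbar q) S ↔
        S = -(Podles.hodge q ∘ₗ Podles.del q ∘ₗ Podles.hodge q)) :=
  ⟨(Podles.isAdjoint_extd q).iff_eq, (Podles.isAdjoint_del q).iff_eq,
    (Podles.isAdjoint_delbar q).iff_eq⟩
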